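/- **Theorem.** For an integer $k\ge 3$, a *$k$-polyomino* is a finite, nonempty set of congruent (solid) regular $k$-gons in the Euclidean plane, called *cells*, such that any two different cells have disjoint interiors and the cells are connected edge-to-edge, i.e. the graph whose vertices are the cells, two different cells being adjacent when they have a common (full) edge, is connected. The size of the cells is fixed once and for all. Two $k$-polyominoes are isomorphic if some isometry of the plane (rotations, translations and reflections are all allowed) maps the set of cells of one onto the set of cells of the other. Let $a_k(n)$ be the number of isomorphism classes of $k$-polyominoes with exactly $n$ cells. Then for every $k\ge 3$ $$ a_k(4)=\begin{cases} \frac{3k^2+8k+24}{24} & k\equiv 0 \pmod{12},\\[2pt] \frac{3k^2+4k-7}{24} & k\equiv 1 \pmod{12},\\[2pt] \frac{3k^2+8k-4}{24} & k\equiv 2 \pmod{12},\\[2pt] \frac{3k^2+10k+15}{24} & k\equiv 3 \pmod{12},\\[2pt] \frac{3k^2+14k+16}{24} & k\equiv 4 \pmod{12},\\[2pt] \frac{3k^2+16k+13}{24} & k\equiv 5 \pmod{12},\\[2pt] \frac{3k^2+8k+12}{24} & k\equiv 6 \pmod{12},\\[2pt] \frac{3k^2+4k-7}{24} & k\equiv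 7 \pmod{12},\\[2pt] \frac{3k^2+8k+8}{24} & k\equiv 8 \pmod{12},\\[2pt] \frac{3k^2+10k+3}{24} & k\equiv 9 \pmod{12},\\[2pt] \frac{3k^2+14k+16}{24} & k\equiv 10 \pmod{12},\\[2pt] \frac{3k^2+16k+13}{24} & k\equiv 11 \pmod{12}. \end{cases} $$ Thus $a_k(4)$ is a quadratic quasi-polynomial in $k$ (for $k\ge 3$) with period $12$. -/

import Mathlib

/-! Polyominoes made of regular `k`-gons in the Euclidean plane, identified with `ℂ`. -/

namespace KPoly

/-- The `j`-th vertex of the regular `k`-gon with centre `c` having `c + u` as a vertex. -/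
noncomputable def vertex (k : ℕ) (c u : ℂ) (j : ℕ) : ℂ :=
  c + u * Complex.exp (2 * Real.pi * Complex.I * j / k)

/-- The (solid, closed) regular `k`-gon with centre `c` having `c + u` as a vertex. -/
noncomputable def regularPolygon (k : ℕ) (c u : ℂ) : Set ℂ :=
  convexHull ℝ (Set.range (vertex k c u))

/-- A cell: a regular `k`-gon in any position in the plane. All cells have the same size,
normalized to circumradius `1`. There are no regular `k`-gons for `k < 3`. -/
def IsCell (k : ℕ) (C : Set ℂ) : Prop :=
  3 ≤ k ∧ ∃ c u : ℂ, ‖u‖ = 1 ∧ C = regularPolygon k c u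

/-- `E` is an edge (a full side) of the regular `k`-gon `C`. -/
def IsEdge (k : ℕ) (C E : Set ℂ) : Prop :=
  ∃ (c u : ℂ) (j : ℕ), ‖u‖ = 1 ∧ C = regularPolygon k c u ∧
    E = segment ℝ (vertex k c u j) (vertex k c u (j + 1))

/-- The neighbour relation: two different cells are joined edge-to-edge when they have a
common edge. -/
def cellGraph (k : ℕ) : SimpleGraph (Set ℂ) where
  Adj C D := C ≠ D ∧ ∃ E, IsEdge k C E ∧ IsEdge k D E
  symm := ⟨fun _ _ ⟨h, E, h₁, h₂⟩ => ⟨h.symm, E, h₂, h₁⟩⟩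
  loopless := ⟨fun _ h => h.1 rfl⟩

/-- `P` is the set of cells of a `k`-polyomino with `n` cells: there are exactly `n` cells,
no two of them overlap, and they are connected edge-to-edge. -/
structure IsPolyomino (k n : ℕ) (P : Set (Set ℂ)) : Prop where
  encard_eq : P.encard = n
  isCell : ∀ C ∈ P, IsCell k C
  nonoverlapping : ∀ C ∈ P, ∀ D ∈ P, C ≠ D → Disjoint (interior C) (interior D)
  connected : ((cellGraph k).induce P).Connected

/-- Two `k`-polyominoes are isomorphic if an isometry of the plane (possibly
orientation-reversing) maps the cells of the first onto the cells of the second. -/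
def isoSetoid (k n : ℕ) : Setoid {P : Set (Set ℂ) // IsPolyomino k n P} where
  r P Q := ∃ e : ℂ ≃ᵢ ℂ, Q.1 = (fun C : Set ℂ => e '' C) '' P.1
  iseqv :=
    { refl := fun P => ⟨IsometryEquiv.refl ℂ, by
        change P.1 = (fun C : Set ℂ => id '' C) '' P.1
        simp only [Set.image_id, Set.image_id']⟩
      symm := by
        rintro P Q ⟨e, h⟩
        refine ⟨e.symm, ?_⟩
        simp only [h, Set.image_image, IsometryEquiv.symm_apply_apply, Set.image_id']
      trans := by
        rintro P Q R ⟨e, h⟩ ⟨f, h'⟩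
        refine ⟨e.trans f, ?_⟩
        simp only [h', h, Set.image_image]
        rfl }

/-- The number `a_k(n)` of nonisomorphic `k`-polyominoes consisting of `n` cells. -/
noncomputable def a (k n : ℕ) : ℕ :=
  Nat.card (Quotient (isoSetoid k n))

end KPoly

/-!
The number of `k`-polyominoes with four cells is found by listing normal forms up to congruence and
counting the parameters.

**Geometry.** A cell is recorded as `cell k c w`: its centre `c` and the normal `w` of one of its
edges, which the cell determines up to the rotations `dir k (2 * j)` (`center_eq_of_cell_eq`,
`exists_dir_of_cell_eq`). The neighbours of a cell are its reflections in its edges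
(`adj_cell_iff`), so centres of adjacent cells have distance `step k`, twice the apothem. Cells whose
centres are closer than that overlap, since a cell contains its inscribed disk
(`closedBall_subset_cell`), and cells whose centres have distance at least `2` do not. The few
pairs in between which occur here are separated by a line: adjacent cells by their common edge, and
consecutive neighbours of a triangle or a pentagon by an axis of symmetry (`disjoint_consecutive`).
Estimates for cosines then give two rules: neighbours of a common cell do not overlap if and only if
they are at least a sixth of a turn apart (`disjoint_nbr_nbr`, `gap_le`), and the two ends of a chain
of four cells bending to the same side by `p` and `q` edges do not overlap if and only if
`k ≤ 2 * (p + q)` (`disjoint_ends_same`, `le_of_disjoint_ends`), while ends on opposite sides never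
overlap (`disjoint_ends_opposite`).

**Classification.** A connected graph with four vertices has a spanning star or a spanning path. A
star is given by the three gaps between consecutive neighbours of its central cell, whose order is
irrelevant up to congruence. A chain is given by the two bends, up to exchange and a common change of
sign; a bend of exactly a sixth of a turn gives three mutually adjacent cells and hence a star, so
only chains with larger bends are listed (`isStar_or_isChain`). Conversely the distances between the
centres, an invariant of the congruence class, tell all the normal forms apart
(`polyominoOfCode_injective`): a chain without triangles has no cell adjacent to the three others,
and in the rhombic chains, where the two ends are adjacent as well, all four ways of cutting the
rhombus open give the same pair of bends.

**Counting.** Hence `a k 4` is the number of partitions of `k` into three parts at least `k / 6`,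
plus the numbers of admissible pairs of bends for chains with ends on the same and on opposite sides
(`a_four_eq`). Up to translation the pairs to be counted are `partPairs`,
`boxPairs` and `sumPairs` (`card_codes`), and their numbers satisfy recursions obtained by subtracting
`(1, 1)` from the pairs without zero entry (`card_eq_add_of_shift`).
-/

namespace KPoly

/-! ### Cells described by their edge normals -/

/-- The unit vector at angle `π m / k`. -/
noncomputable def dir (k : ℕ) (m : ℤ) : ℂ := Complex.exp (((Real.pi * m / k : ℝ) : ℂ) * Complex.I)

/-- The distance between the centres of two cells with a common edge: twice the apothem. -/
noncomputable def step (k : ℕ) : ℝ := 2 * Real.cos (Real.pi / k)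

/-- The cell with centre `c` whose edges have the outer normals `w * dir k (2 * j)`; this way of
recording the position is symmetric under reflections. -/
noncomputable def cell (k : ℕ) (c w : ℂ) : Set ℂ := regularPolygon k c (w * dir k (-1))

variable {k : ℕ}

lemma dir_add (m n : ℤ) : dir k (m + n) = dir k m * dir k n := by
  rw [dir, dir, dir, ← Complex.exp_add]
  congr 1
  push_cast
  ring

@[simp] lemma dir_zero : dir k 0 = 1 := by simp [dir]

@[simp] lemma norm_dir (m : ℤ) : ‖dir k m‖ = 1 := Complex.norm_exp_ofReal_mul_I _

lemma dir_ne_zero (m : ℤ) : dir k m ≠ 0 := Complex.exp_ne_zero _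

lemma dir_mul_dir_neg (m : ℤ) : dir k m * dir k (-m) = 1 := by
  rw [← dir_add]; simp

lemma dir_re (m : ℤ) : (dir k m).re = Real.cos (Real.pi * m / k) :=
  Complex.exp_ofReal_mul_I_re _

lemma dir_im (m : ℤ) : (dir k m).im = Real.sin (Real.pi * m / k) :=
  Complex.exp_ofReal_mul_I_im _

lemma conj_dir (m : ℤ) : (starRingEnd ℂ) (dir k m) = dir k (-m) := by
  apply Complex.ext
  · rw [Complex.conj_re, dir_re, dir_re]
    rw [show Real.pi * ((-m : ℤ) : ℝ) / k = -(Real.pi * m / k) by push_cast; ring, Real.cos_neg]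
  · rw [Complex.conj_im, dir_im, dir_im]
    rw [show Real.pi * ((-m : ℤ) : ℝ) / k = -(Real.pi * m / k) by push_cast; ring, Real.sin_neg]

lemma dir_self (hk : 3 ≤ k) : dir k k = -1 := by
  have : (k : ℝ) ≠ 0 := by positivity
  rw [dir, ← Complex.exp_pi_mul_I]
  congr 2
  push_cast
  have : (k : ℂ) ≠ 0 := by exact_mod_cast this
  field_simp

lemma dir_two_mul_mul_self (hk : 3 ≤ k) (j : ℤ) : dir k (2 * (j * k)) = 1 := by
  have : (k : ℝ) ≠ 0 := by positivity
  rw [dir, Complex.exp_eq_one_iff]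
  refine ⟨j, ?_⟩
  have : (k : ℂ) ≠ 0 := by exact_mod_cast this
  push_cast
  field_simp

lemma dir_one_add_dir_neg_one : dir k 1 + dir k (-1) = step k := by
  apply Complex.ext
  · rw [Complex.add_re, dir_re, dir_re, Complex.ofReal_re, step]
    simp only [Int.cast_one, Int.cast_neg, mul_one, mul_neg, neg_div, Real.cos_neg]
    ring
  · simp [dir_im, neg_div]

lemma step_pos (hk : 3 ≤ k) : 0 < step k := by
  have h3 : (3 : ℝ) ≤ k := by exact_mod_cast hk
  have : 0 < Real.cos (Real.pi / k) := by
    apply Real.cos_pos_of_mem_Ioo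
    have := Real.pi_pos
    constructor
    · have : 0 < Real.pi / k := by positivity
      linarith
    · apply div_lt_div_of_pos_left <;> linarith
  unfold step; linarith

lemma vertex_eq (c u : ℂ) (j : ℕ) : vertex k c u j = c + u * dir k (2 * j) := by
  rw [vertex, dir]
  congr 3
  push_cast
  ring

/-- Vertices may be indexed by all integers. -/
lemma range_vertex (hk : 3 ≤ k) (c u : ℂ) :
    Set.range (vertex k c u) = Set.range fun j : ℤ => c + u * dir k (2 * j) := by
  ext z
  constructor
  · rintro ⟨j, rfl⟩
    exact ⟨j, (vertex_eq c u j).symm⟩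
  · rintro ⟨j, rfl⟩
    refine ⟨(j % k).toNat, ?_⟩
    have h0 : 0 ≤ j % (k : ℤ) := Int.emod_nonneg _ (by omega)
    rw [vertex_eq, Int.toNat_of_nonneg h0]
    have : 2 * j = 2 * (j % k) + 2 * (j / k * k) := by
      have := Int.emod_add_mul_ediv j k
      linarith
    simp only
    rw [this, dir_add, dir_two_mul_mul_self hk, mul_one]

lemma cell_eq_hull (hk : 3 ≤ k) (c w : ℂ) :
    cell k c w = convexHull ℝ (Set.range fun j : ℤ => c + w * dir k (2 * j - 1)) := by
  rw [cell, regularPolygon, range_vertex hk]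
  congr 2
  funext j
  rw [mul_assoc, ← dir_add]
  congr 3; ring

lemma regularPolygon_eq_cell (c u : ℂ) : regularPolygon k c u = cell k c (u * dir k 1) := by
  rw [cell, mul_assoc, dir_mul_dir_neg, mul_one]

lemma vertex_mem_cell (hk : 3 ≤ k) (c w : ℂ) (j : ℤ) : c + w * dir k (2 * j - 1) ∈ cell k c w := by
  rw [cell_eq_hull hk]
  exact subset_convexHull ℝ _ ⟨j, rfl⟩

lemma isCell_cell (hk : 3 ≤ k) {c w : ℂ} (hw : ‖w‖ = 1) : IsCell k (cell k c w) :=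
  ⟨hk, c, w * dir k (-1), by simp [hw], rfl⟩

lemma exists_cell_eq {C : Set ℂ} (h : IsCell k C) : ∃ c w : ℂ, ‖w‖ = 1 ∧ C = cell k c w := by
  obtain ⟨_, c, u, hu, rfl⟩ := h
  exact ⟨c, u * dir k 1, by simp [hu], regularPolygon_eq_cell c u⟩

lemma cell_mul_dir (hk : 3 ≤ k) (c w : ℂ) (j : ℤ) : cell k c (w * dir k (2 * j)) = cell k c w := by
  rw [cell_eq_hull hk, cell_eq_hull hk]
  congr 1
  ext z
  constructor
  · rintro ⟨i, rfl⟩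
    refine ⟨i + j, ?_⟩
    simp only
    rw [mul_assoc, ← dir_add]
    congr 3; ring
  · rintro ⟨i, rfl⟩
    refine ⟨i - j, ?_⟩
    simp only
    rw [mul_assoc, ← dir_add]
    congr 3; ring

lemma norm_mul_dir {w : ℂ} (hw : ‖w‖ = 1) (m : ℤ) : ‖w * dir k m‖ = 1 := by
  simp [hw]

lemma cell_subset_closedBall (hk : 3 ≤ k) {c w : ℂ} (hw : ‖w‖ = 1) :
    cell k c w ⊆ Metric.closedBall c 1 := by
  rw [cell_eq_hull hk]
  apply convexHull_min _ (convex_closedBall c 1)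
  rintro _ ⟨j, rfl⟩
  simp [hw]

/-- In every direction `a` some vertex of a cell lies at angle at most `π / k` from `a`. -/
lemma exists_vertex_near (hk : 3 ≤ k) {w : ℂ} (hw : ‖w‖ = 1) (a : ℂ) :
    ∃ j : ℤ, ‖a‖ * (step k / 2) ≤ ((starRingEnd ℂ) a * (w * dir k (2 * j - 1))).re := by
  have hk0 : (0 : ℝ) < k := by positivity
  have hpi := Real.pi_pos
  set φ := Complex.arg w
  set θ := Complex.arg a
  set x : ℝ := ((θ - φ) * k / Real.pi + 1) / 2
  refine ⟨round x, ?_⟩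
  have hwe : w = Complex.exp (φ * Complex.I) := by
    have := Complex.norm_mul_exp_arg_mul_I w
    rw [hw] at this; simpa using this.symm
  have hae : (starRingEnd ℂ) a = ‖a‖ * Complex.exp (((-θ : ℝ) : ℂ) * Complex.I) := by
    conv_lhs => rw [← Complex.norm_mul_exp_arg_mul_I a]
    rw [map_mul, ← Complex.exp_conj]
    simp [θ]
  have key : (starRingEnd ℂ) a * (w * dir k (2 * round x - 1)) =
      ‖a‖ * Complex.exp (((2 * Real.pi / k * (round x - x) : ℝ) : ℂ) * Complex.I) := by
    rw [hae, hwe, dir, mul_assoc, ← Complex.exp_add, ← Complex.exp_add]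
    congr 2
    rw [← add_mul, ← add_mul]
    congr 1
    rw [← Complex.ofReal_add, ← Complex.ofReal_add]
    congr 1
    simp only [x]
    push_cast
    field_simp
    ring
  rw [key, Complex.re_ofReal_mul, Complex.exp_ofReal_mul_I_re]
  apply mul_le_mul_of_nonneg_left _ (norm_nonneg a)
  have habs := abs_sub_round x
  rw [step, mul_div_cancel_left₀ _ (by norm_num : (2 : ℝ) ≠ 0), ← Real.cos_abs (2 * _ / _ * _)]
  have h3 : (3 : ℝ) ≤ k := by exact_mod_cast hk
  apply Real.cos_le_cos_of_nonneg_of_le_pi (abs_nonneg _)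
  · rw [div_le_iff₀ hk0]; nlinarith
  · rw [abs_mul, abs_sub_comm, abs_of_pos (by positivity)]
    calc 2 * Real.pi / k * |x - round x| ≤ 2 * Real.pi / k * (1 / 2) := by gcongr
      _ = Real.pi / k := by ring

/-- A cell contains its inscribed disk. -/
lemma closedBall_subset_cell (hk : 3 ≤ k) {c w : ℂ} (hw : ‖w‖ = 1) :
    Metric.closedBall c (step k / 2) ⊆ cell k c w := by
  intro z hz
  by_contra hn
  have hfin : (Set.range fun j : ℤ => c + w * dir k (2 * j - 1)).Finite := by
    have h1 : (Set.range fun j : ℤ => c + w * dir k (2 * j - 1)) ⊆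
        (fun i : ℕ => c + (w * dir k (-1)) * dir k (2 * i)) '' (Set.Iio k) := by
      rintro _ ⟨j, rfl⟩
      have h0 : 0 ≤ j % (k : ℤ) := Int.emod_nonneg _ (by omega)
      have h1 : j % (k : ℤ) < k := Int.emod_lt_of_pos _ (by omega)
      refine ⟨(j % k).toNat, by simp only [Set.mem_Iio]; omega, ?_⟩
      simp only
      rw [Int.toNat_of_nonneg h0]
      have : 2 * j - 1 = -1 + 2 * (j % k) + 2 * (j / k * k) := by
        have := Int.emod_add_mul_ediv j k
        linarith
      rw [this, dir_add, dir_two_mul_mul_self hk, mul_one, dir_add, mul_assoc]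
    exact ((Set.finite_Iio k).image _).subset h1
  rw [cell_eq_hull hk] at hn
  obtain ⟨f, t, hft, htz⟩ := geometric_hahn_banach_closed_point (convex_convexHull ℝ _)
    (hfin.isClosed_convexHull ℝ) hn
  set a : ℂ := ⟨f 1, f Complex.I⟩
  have hf : ∀ v : ℂ, f v = ((starRingEnd ℂ) a * v).re := by
    intro v
    have : v = v.re • (1 : ℂ) + v.im • Complex.I := by
      apply Complex.ext <;> simp
    conv_lhs => rw [this]
    rw [map_add, map_smul, map_smul]
    simp [a]; ring
  obtain ⟨j, hj⟩ := exists_vertex_near hk hw a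
  have h1 := hft _ (subset_convexHull ℝ _ ⟨j, rfl⟩)
  simp only at h1
  rw [map_add, hf (w * _)] at h1
  have h2 : f (z - c) ≤ ‖a‖ * (step k / 2) := by
    rw [hf]
    refine (Complex.re_le_norm _).trans ?_
    rw [norm_mul, Complex.norm_conj]
    apply mul_le_mul_of_nonneg_left _ (norm_nonneg a)
    simpa [dist_eq_norm] using hz
  rw [map_sub] at h2
  linarith

/-- Points of a cell on its circumscribed circle are vertices. -/
lemma eq_vertex_of_norm_eq_one (hk : 3 ≤ k) {c w v : ℂ} (hw : ‖w‖ = 1) (hv : ‖v‖ = 1)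
    (h : c + v ∈ cell k c w) : ∃ j : ℤ, v = w * dir k (2 * j - 1) := by
  by_contra! hn
  have hsub : cell k c w ⊆ {z | ((starRingEnd ℂ) v * (z - c)).re < 1} := by
    rw [cell_eq_hull hk]
    apply convexHull_min
    · rintro _ ⟨j, rfl⟩
      have h1 := hn j
      have h2 := norm_mul_dir (k := k) hw (2 * j - 1)
      set y := w * dir k (2 * j - 1)
      simp only [Set.mem_ofPred_eq, add_sub_cancel_left]
      have h3 : 0 < ‖v - y‖ := norm_pos_iff.2 (sub_ne_zero.2 h1)
      have h4 : ‖v - y‖ ^ 2 = 2 - 2 * ((starRingEnd ℂ) v * y).re := by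
        have hv2 : v.re * v.re + v.im * v.im = 1 := by
          rw [← Complex.normSq_apply, Complex.normSq_eq_norm_sq, hv]; norm_num
        have hy2 : y.re * y.re + y.im * y.im = 1 := by
          rw [← Complex.normSq_apply, Complex.normSq_eq_norm_sq, h2]; norm_num
        rw [← Complex.normSq_eq_norm_sq, Complex.normSq_apply]
        simp
        linear_combination hv2 + hy2
      nlinarith [sq_nonneg ‖v - y‖, pow_pos h3 2]
    · have : {z | ((starRingEnd ℂ) v * (z - c)).re < 1} =
          {z | (v.re * z.re + v.im * z.im) < 1 + (v.re * c.re + v.im * c.im)} := by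
        ext z
        simp
        constructor <;> intro <;> linarith
      rw [this]
      apply convex_halfSpace_lt
      constructor
      · intro x y; simp; ring
      · intro x y; simp; ring
  have := hsub h
  simp only [Set.mem_ofPred_eq, add_sub_cancel_left] at this
  rw [← Complex.normSq_eq_conj_mul_self, Complex.ofReal_re, Complex.normSq_eq_norm_sq, hv] at this
  norm_num at this

/-- The centre of a cell is determined by the cell, as the centre of its smallest enclosing
disk. -/
lemma center_eq_of_cell_eq (hk : 3 ≤ k) {c w c' w' : ℂ} (hw : ‖w‖ = 1) (hw' : ‖w'‖ = 1)
    (h : cell k c w = cell k c' w') : c = c' := by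
  by_contra hne
  obtain ⟨j, hj⟩ := exists_vertex_near hk hw (c - c')
  have h1 := vertex_mem_cell hk c w j
  rw [h] at h1
  have h1 := cell_subset_closedBall hk hw' h1
  have h2 := norm_mul_dir (k := k) hw (2 * j - 1)
  set y := w * dir k (2 * j - 1)
  rw [mem_closedBall_iff_norm] at h1
  have h3 : 0 < ‖c - c'‖ := norm_pos_iff.2 (sub_ne_zero.2 hne)
  have h4 : ‖c + y - c'‖ ^ 2 = ‖c - c'‖ ^ 2 + ‖y‖ ^ 2 + 2 * ((starRingEnd ℂ) (c - c') * y).re := by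
    rw [← Complex.normSq_eq_norm_sq, ← Complex.normSq_eq_norm_sq, ← Complex.normSq_eq_norm_sq,
      Complex.normSq_apply, Complex.normSq_apply, Complex.normSq_apply]
    simp
    ring
  have h5 : 0 < ‖c - c'‖ * (step k / 2) := by have := step_pos hk; positivity
  rw [h2] at h4
  nlinarith [norm_nonneg (c + y - c'), pow_pos h3 2]

lemma exists_dir_of_cell_eq (hk : 3 ≤ k) {c w w' : ℂ} (hw : ‖w‖ = 1) (hw' : ‖w'‖ = 1)
    (h : cell k c w = cell k c w') : ∃ j : ℤ, w' = w * dir k (2 * j) := by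
  have h1 := vertex_mem_cell hk c w' 0
  rw [← h] at h1
  obtain ⟨j, hj⟩ := eq_vertex_of_norm_eq_one hk hw (by simp [hw']) h1
  refine ⟨j, ?_⟩
  have : w' * dir k (2 * 0 - 1) * dir k 1 = w * dir k (2 * j - 1) * dir k 1 := by rw [hj]
  rw [mul_assoc, mul_assoc, ← dir_add, ← dir_add] at this
  simpa using this

/-- A nondegenerate segment determines its end points up to order. -/
lemma segment_endpoints {a b a' b' : ℂ} (hab : a ≠ b) (h : segment ℝ a b = segment ℝ a' b') :
    (a = a' ∧ b = b') ∨ (a = b' ∧ b = a') := by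
  have ha : a ∈ segment ℝ a' b' := h ▸ left_mem_segment ℝ a b
  have hb : b ∈ segment ℝ a' b' := h ▸ right_mem_segment ℝ a b
  have ha' : a' ∈ segment ℝ a b := h ▸ left_mem_segment ℝ a' b'
  have hb' : b' ∈ segment ℝ a b := h ▸ right_mem_segment ℝ a' b'
  rw [segment_eq_image'] at ha hb ha' hb'
  obtain ⟨t, ⟨ht0, ht1⟩, ht⟩ := ha
  obtain ⟨s, ⟨hs0, hs1⟩, hs⟩ := hb
  obtain ⟨t', ⟨ht0', ht1'⟩, ht'⟩ := ha'
  obtain ⟨s', ⟨hs0', hs1'⟩, hs'⟩ := hb'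
  simp only [Complex.real_smul] at ht hs ht' hs'
  have h1 : b - a = (s - t) * (b' - a') := by rw [← ht, ← hs]; ring
  have h2 : b' - a' = (s' - t') * (b - a) := by
    conv_lhs => rw [← ht', ← hs']
    ring
  have h3 : ((s - t) * (s' - t') : ℂ) = 1 := by
    have : (b - a) * ((s - t) * (s' - t') - 1 : ℂ) = 0 := by
      linear_combination (-1 : ℂ) * h1 - (s - t : ℂ) * h2
    rcases mul_eq_zero.1 this with h | h
    · exact absurd (sub_eq_zero.1 h).symm hab
    · exact sub_eq_zero.1 h
  have h4 : (s - t) * (s' - t') = 1 := by exact_mod_cast h3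
  rcases le_total t s with hts | hts
  · have : s = 1 ∧ t = 0 := by constructor <;> nlinarith
    left
    obtain ⟨rfl, rfl⟩ := this
    constructor
    · rw [← ht]; simp
    · rw [← hs]; simp
  · have : t = 1 ∧ s = 0 := by constructor <;> nlinarith
    right
    obtain ⟨rfl, rfl⟩ := this
    constructor
    · rw [← ht]; simp
    · rw [← hs]; simp

lemma dir_one_ne_dir_neg_one (hk : 3 ≤ k) : dir k 1 ≠ dir k (-1) := by
  intro h
  have h1 : dir k 2 = 1 := by
    rw [show (2 : ℤ) = 1 + 1 by norm_num, dir_add]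
    conv_lhs => rw [h]
    rw [← h, mul_comm]
    exact (congrArg (· * dir k 1) h).trans (by rw [mul_comm]; exact dir_mul_dir_neg 1)
  have hk3 : (3 : ℝ) ≤ k := by exact_mod_cast hk
  have h2 := congrArg Complex.im h
  rw [dir_im, dir_im] at h2
  have h3 : 0 < Real.sin (Real.pi / k) := by
    apply Real.sin_pos_of_pos_of_lt_pi
    · have := Real.pi_pos; positivity
    · apply div_lt_self Real.pi_pos; linarith
  simp [neg_div] at h2
  linarith

lemma isEdge_cell_iff (hk : 3 ≤ k) {c w : ℂ} (hw : ‖w‖ = 1) {E : Set ℂ} :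
    IsEdge k (cell k c w) E ↔
      ∃ j : ℤ, E = segment ℝ (c + w * dir k (2 * j - 1)) (c + w * dir k (2 * j + 1)) := by
  constructor
  · rintro ⟨c', u, j, hu, h, rfl⟩
    rw [regularPolygon_eq_cell] at h
    have hu' : ‖u * dir k 1‖ = 1 := by simp [hu]
    obtain rfl := center_eq_of_cell_eq hk hw hu' h
    obtain ⟨i, hi⟩ := exists_dir_of_cell_eq hk hw hu' h
    have hu2 : u = w * dir k (2 * i - 1) := by
      have : u * dir k 1 * dir k (-1) = w * dir k (2 * i) * dir k (-1) := by rw [hi]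
      rw [mul_assoc, mul_assoc, ← dir_add, ← dir_add] at this
      simpa [sub_eq_add_neg] using this
    refine ⟨i + j, ?_⟩
    rw [vertex_eq, vertex_eq, hu2, mul_assoc, mul_assoc, ← dir_add, ← dir_add]
    push_cast
    ring_nf
  · rintro ⟨j, rfl⟩
    refine ⟨c, w * dir k (2 * j - 1), 0, by simp [hw], ?_, ?_⟩
    · rw [regularPolygon_eq_cell, mul_assoc, ← dir_add, sub_add_cancel, cell_mul_dir hk]
    · rw [vertex_eq, vertex_eq, mul_assoc, mul_assoc, ← dir_add, ← dir_add]
      push_cast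
      ring_nf

lemma step_mul_dir (m : ℤ) : (step k : ℂ) * dir k m = dir k (m - 1) + dir k (m + 1) := by
  rw [← dir_one_add_dir_neg_one, sub_eq_add_neg, dir_add, dir_add]; ring

/-- The cells with an edge in common with a given cell are its reflections in its edges. -/
lemma adj_cell_iff (hk : 3 ≤ k) {c w : ℂ} (hw : ‖w‖ = 1) {D : Set ℂ} :
    (cellGraph k).Adj (cell k c w) D ↔
      ∃ j : ℤ, D = cell k (c + step k * (w * dir k (2 * j))) (-w) := by
  have hw0 : w ≠ 0 := by rintro rfl; simp at hw
  have hne : ∀ j : ℤ, c + w * dir k (2 * j - 1) ≠ c + w * dir k (2 * j + 1) := by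
    intro j h
    have h := mul_left_cancel₀ hw0 (add_left_cancel h)
    rw [sub_eq_add_neg, dir_add, dir_add] at h
    exact dir_one_ne_dir_neg_one hk (mul_left_cancel₀ (dir_ne_zero _) h).symm
  constructor
  · rintro ⟨hCD, E, hE, ⟨c', u, i, hu, rfl, hE'⟩⟩
    obtain ⟨j, rfl⟩ := (isEdge_cell_iff hk hw).1 hE
    rw [vertex_eq, vertex_eq] at hE'
    push_cast at hE'
    set v : ℂ := u * dir k (2 * i + 1) with hv
    have hvn : ‖v‖ = 1 := by simp [hv, hu]
    have hcell : regularPolygon k c' u = cell k c' v := by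
      rw [regularPolygon_eq_cell, hv, dir_add, mul_comm (dir k _), ← mul_assoc, cell_mul_dir hk]
    have h1 : u * dir k (2 * i) = v * dir k (-1) := by
      rw [hv, mul_assoc, ← dir_add]; ring_nf
    have h2 : u * dir k (2 * (i + 1)) = v * dir k 1 := by
      rw [hv, mul_assoc, ← dir_add]; ring_nf
    have h3 : w * dir k (2 * j - 1) = w * dir k (2 * j) * dir k (-1) := by
      rw [mul_assoc, ← dir_add]; ring_nf
    have h4 : w * dir k (2 * j + 1) = w * dir k (2 * j) * dir k 1 := by
      rw [mul_assoc, ← dir_add]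
    have hnej := hne j
    rw [h1, h2, h3, h4] at hE'
    rw [h3, h4] at hnej
    rw [hcell] at hCD ⊢
    set y := w * dir k (2 * j)
    have hd : dir k 1 - dir k (-1) ≠ 0 := sub_ne_zero.2 (dir_one_ne_dir_neg_one hk)
    rcases segment_endpoints hnej hE' with ⟨h5, h6⟩ | ⟨h5, h6⟩
    · exfalso
      have hvy : v = y := by
        apply mul_right_cancel₀ hd
        linear_combination h5 - h6
      have hcc : c' = c := by
        rw [hvy] at h5; exact (add_right_cancel h5).symm
      apply hCD
      rw [hvy, hcc]
      exact (cell_mul_dir hk c w j).symm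
    · have hvy : v = -y := by
        apply mul_right_cancel₀ hd
        linear_combination h6 - h5
      have hcc : c' = c + step k * y := by
        rw [← dir_one_add_dir_neg_one]
        rw [hvy] at h5
        linear_combination -h5
      refine ⟨j, ?_⟩
      rw [hvy, hcc, ← neg_mul, cell_mul_dir hk]
  · rintro ⟨j, rfl⟩
    have hw' : ‖-w‖ = 1 := by simpa using hw
    refine ⟨?_, _, (isEdge_cell_iff hk hw).2 ⟨j, rfl⟩, ?_⟩
    · intro h
      have h := center_eq_of_cell_eq hk hw hw' h
      have h1 : (step k : ℂ) * (w * dir k (2 * j)) = 0 := by linear_combination -h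
      have h2 : (step k : ℂ) ≠ 0 := by exact_mod_cast (step_pos hk).ne'
      simp [h2, hw0, dir_ne_zero] at h1
    · rw [isEdge_cell_iff hk hw']
      refine ⟨j, ?_⟩
      rw [segment_symm]
      have h := step_mul_dir (k := k) (2 * j)
      congr 1 <;> linear_combination (-w) * h

/-! ### Images of cells under isometries -/

lemma image_cell (hk : 3 ≤ k) (e : ℂ ≃ᵢ ℂ) (c w : ℂ) :
    e '' cell k c w = convexHull ℝ (Set.range fun j : ℤ => e (c + w * dir k (2 * j - 1))) := by
  have h := e.toRealAffineIsometryEquiv.toAffineEquiv.toAffineMap.image_convexHull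
    (Set.range fun j : ℤ => c + w * dir k (2 * j - 1))
  rw [cell_eq_hull hk]
  refine Eq.trans h ?_
  rw [← Set.range_comp]
  rfl

lemma image_cell_rotation (hk : 3 ≤ k) {e : ℂ ≃ᵢ ℂ} {a b : ℂ} (he : ∀ z, e z = a * z + b)
    (c w : ℂ) : e '' cell k c w = cell k (a * c + b) (a * w) := by
  rw [image_cell hk, cell_eq_hull hk]
  congr 2
  funext j
  rw [he]; ring

lemma image_cell_reflection (hk : 3 ≤ k) {e : ℂ ≃ᵢ ℂ} {a b : ℂ}
    (he : ∀ z, e z = a * (starRingEnd ℂ) z + b) (c w : ℂ) :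
    e '' cell k c w = cell k (a * (starRingEnd ℂ) c + b) (a * (starRingEnd ℂ) w) := by
  rw [image_cell hk, cell_eq_hull hk]
  congr 1
  ext z
  constructor
  · rintro ⟨j, rfl⟩
    refine ⟨1 - j, ?_⟩
    simp only
    rw [he, map_add, map_mul, conj_dir]
    rw [show 2 * (1 - j) - 1 = -(2 * j - 1) by ring]; ring
  · rintro ⟨j, rfl⟩
    refine ⟨1 - j, ?_⟩
    simp only
    rw [he, map_add, map_mul, conj_dir]
    rw [show 2 * j - 1 = -(2 * (1 - j) - 1) by ring]; ring

lemma exists_rotation {a : ℂ} (ha : ‖a‖ = 1) (b : ℂ) : ∃ e : ℂ ≃ᵢ ℂ, ∀ z, e z = a * z + b := by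
  refine ⟨(rotation ⟨a, by simp [Submonoid.unitSphere, ha]⟩).toIsometryEquiv.trans
    (IsometryEquiv.addRight b), fun z => ?_⟩
  rfl

lemma exists_reflection {a : ℂ} (ha : ‖a‖ = 1) (b : ℂ) :
    ∃ e : ℂ ≃ᵢ ℂ, ∀ z, e z = a * (starRingEnd ℂ) z + b := by
  obtain ⟨e, he⟩ := exists_rotation ha b
  exact ⟨Complex.conjLIE.toIsometryEquiv.trans e, fun z => he _⟩

lemma isometry_eq (e : ℂ ≃ᵢ ℂ) : ∃ a b : ℂ, ‖a‖ = 1 ∧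
    ((∀ z, e z = a * z + b) ∨ ∀ z, e z = a * (starRingEnd ℂ) z + b) := by
  set f := e.toRealAffineIsometryEquiv
  have hf : ∀ z, e z = f.linearIsometryEquiv z + e 0 := by
    intro z
    have := f.map_vadd 0 z
    simpa [f] using this
  obtain ⟨a, ha⟩ := linear_isometry_complex f.linearIsometryEquiv
  refine ⟨a, e 0, Circle.norm_coe a, ha.imp (fun h z => ?_) fun h z => ?_⟩
  · rw [hf, h]; simp
  · rw [hf, h]; simp

/-- An isometry maps cells to cells, and centres to centres. -/
lemma exists_image_cell (hk : 3 ≤ k) (e : ℂ ≃ᵢ ℂ) (c : ℂ) {w : ℂ} (hw : ‖w‖ = 1) :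
    ∃ w' : ℂ, ‖w'‖ = 1 ∧ e '' cell k c w = cell k (e c) w' := by
  obtain ⟨a, b, ha, h | h⟩ := isometry_eq e
  · exact ⟨a * w, by simp [ha, hw], by rw [image_cell_rotation hk h, h]⟩
  · exact ⟨a * (starRingEnd ℂ) w, by simp [ha, hw], by rw [image_cell_reflection hk h, h]⟩

/-! ### Overlapping and nonoverlapping cells -/

lemma step_le_dist_of_disjoint (hk : 3 ≤ k) {c w c' w' : ℂ} (hw : ‖w‖ = 1) (hw' : ‖w'‖ = 1)
    (h : Disjoint (interior (cell k c w)) (interior (cell k c' w'))) : step k ≤ dist c c' := by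
  by_contra! hlt
  have h1 : ∀ {c w : ℂ}, ‖w‖ = 1 → Metric.ball c (step k / 2) ⊆ interior (cell k c w) :=
    fun hw => interior_maximal (Metric.ball_subset_closedBall.trans (closedBall_subset_cell hk hw))
      Metric.isOpen_ball
  refine Set.disjoint_left.1 h (h1 hw (a := midpoint ℝ c c') ?_) (h1 hw' ?_)
  · rw [Metric.mem_ball, dist_midpoint_left]
    norm_num; linarith
  · rw [Metric.mem_ball, dist_midpoint_right]
    norm_num; linarith

lemma disjoint_of_two_le_dist (hk : 3 ≤ k) {c w c' w' : ℂ} (hw : ‖w‖ = 1) (hw' : ‖w'‖ = 1)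
    (h : 2 ≤ dist c c') : Disjoint (interior (cell k c w)) (interior (cell k c' w')) := by
  have h1 : ∀ {c w : ℂ}, ‖w‖ = 1 → interior (cell k c w) ⊆ Metric.ball c 1 := fun {c w} hw => by
    rw [← interior_closedBall c one_ne_zero]
    exact interior_mono (cell_subset_closedBall hk hw)
  exact (Metric.ball_disjoint_ball (by linarith)).mono (h1 hw) (h1 hw')

/-- Two sets on different sides of a line have disjoint interiors. -/
lemma disjoint_interior_of_separated {A B : Set ℂ} {n : ℂ} (hn : n ≠ 0) (t : ℝ)
    (hA : ∀ z ∈ A, ((starRingEnd ℂ) n * z).re ≤ t) (hB : ∀ z ∈ B, t ≤ ((starRingEnd ℂ) n * z).re) :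
    Disjoint (interior A) (interior B) := by
  rw [Set.disjoint_left]
  intro z hzA hzB
  have hc : Filter.Tendsto (fun ε : ℝ => z + ε * n) (nhdsWithin 0 (Set.Ioi 0)) (nhds z) := by
    have : Continuous fun ε : ℝ => z + ε * n := by fun_prop
    have := this.tendsto 0
    simp only [Complex.ofReal_zero, zero_mul, add_zero] at this
    exact this.mono_left nhdsWithin_le_nhds
  obtain ⟨ε, hε, hε0⟩ := ((hc.eventually (isOpen_interior.mem_nhds hzA)).and
    self_mem_nhdsWithin).exists
  have h1 := hA _ (interior_subset hε)
  have h2 := hB _ (interior_subset hzB)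
  have h3 : 0 < n.re * n.re + n.im * n.im := by
    rw [← Complex.normSq_apply]; exact Complex.normSq_pos.2 hn
  have h4 : (0 : ℝ) < ε := hε0
  simp at h1 h2
  nlinarith [mul_pos h4 h3]

lemma cell_subset_of_vertices (hk : 3 ≤ k) {c w : ℂ} {s : Set ℂ} (hs : Convex ℝ s)
    (h : ∀ j : ℤ, c + w * dir k (2 * j - 1) ∈ s) : cell k c w ⊆ s := by
  rw [cell_eq_hull hk]
  exact convexHull_min (by rintro _ ⟨j, rfl⟩; exact h j) hs

lemma convex_re_le (n : ℂ) (t : ℝ) : Convex ℝ {z : ℂ | ((starRingEnd ℂ) n * z).re ≤ t} := by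
  apply convex_halfSpace_le
  constructor
  · intro x y; simp; ring
  · intro x y; simp; ring

lemma convex_le_re (n : ℂ) (t : ℝ) : Convex ℝ {z : ℂ | t ≤ ((starRingEnd ℂ) n * z).re} := by
  apply convex_halfSpace_ge
  constructor
  · intro x y; simp; ring
  · intro x y; simp; ring

lemma cos_odd_le (hk : 3 ≤ k) (i : ℤ) :
    Real.cos (Real.pi * (2 * i - 1 : ℤ) / k) ≤ Real.cos (Real.pi / k) := by
  have hk0 : (0 : ℝ) < k := by positivity
  have hpi := Real.pi_pos
  obtain ⟨r, hr⟩ : ∃ r, r = i % (k : ℤ) := ⟨_, rfl⟩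
  have h0 : 0 ≤ r := hr ▸ Int.emod_nonneg _ (by omega)
  have h1 : r < k := hr ▸ Int.emod_lt_of_pos _ (by omega)
  have hi : i = r + i / k * k := by
    have := Int.emod_add_mul_ediv i k
    rw [hr]; linarith
  have : dir k (2 * i - 1) = dir k (2 * r - 1) := by
    have : 2 * i - 1 = 2 * r - 1 + 2 * (i / k * k) := by linarith
    rw [this, dir_add, dir_two_mul_mul_self hk, mul_one]
  have h2 := congrArg Complex.re this
  rw [dir_re, dir_re] at h2
  rw [h2]
  rcases Int.lt_or_le r 1 with h | h
  · have : r = 0 := by omega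
    subst this
    simp [neg_div]
  · have hr1 : (1 : ℝ) ≤ r := by exact_mod_cast h
    have hrk : (r : ℝ) ≤ k - 1 := by
      have : r ≤ (k : ℤ) - 1 := by omega
      exact_mod_cast this
    push_cast
    rcases le_total (2 * r - 1 : ℝ) k with h3 | h3
    · apply Real.cos_le_cos_of_nonneg_of_le_pi (by positivity)
      · rw [div_le_iff₀ hk0]; nlinarith
      · gcongr; nlinarith
    · rw [← Real.cos_two_pi_sub (Real.pi * (2 * r - 1) / k)]
      apply Real.cos_le_cos_of_nonneg_of_le_pi (by positivity)
      · rw [sub_le_iff_le_add, ← sub_le_iff_le_add', le_div_iff₀ hk0]; nlinarith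
      · rw [le_sub_iff_add_le, ← add_div, div_le_iff₀ hk0]; nlinarith

/-- Cells with a common edge lie on different sides of it. -/
lemma disjoint_of_adj (hk : 3 ≤ k) {C D : Set ℂ} (hC : IsCell k C)
    (h : (cellGraph k).Adj C D) : Disjoint (interior C) (interior D) := by
  obtain ⟨c, w, hw, rfl⟩ := exists_cell_eq hC
  obtain ⟨j, rfl⟩ := (adj_cell_iff hk hw).1 h
  have hn1 : ‖w * dir k (2 * j)‖ = 1 := by simp [hw]
  set n := w * dir k (2 * j) with hn
  have hnn : (starRingEnd ℂ) n * n = 1 := by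
    rw [← Complex.normSq_eq_conj_mul_self, Complex.normSq_eq_norm_sq, hn1]; norm_num
  have hn0 : n ≠ 0 := by intro h; rw [h] at hn1; simp at hn1
  have hv : ∀ i : ℤ, (starRingEnd ℂ) n * (w * dir k (2 * i - 1)) = dir k (2 * (i - j) - 1) := by
    intro i
    have : w * dir k (2 * i - 1) = n * dir k (2 * (i - j) - 1) := by
      rw [hn, mul_assoc, ← dir_add]; congr 2; ring
    rw [this, ← mul_assoc, hnn, one_mul]
  apply disjoint_interior_of_separated hn0 (((starRingEnd ℂ) n * c).re + step k / 2)
  · apply cell_subset_of_vertices hk (convex_re_le n _)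
    intro i
    simp only [Set.mem_ofPred_eq]
    rw [mul_add, hv, Complex.add_re, dir_re, step]
    have := cos_odd_le hk (i - j)
    linarith
  · apply cell_subset_of_vertices hk (convex_le_re n _)
    intro i
    simp only [Set.mem_ofPred_eq]
    have : (starRingEnd ℂ) n * (c + step k * n + -w * dir k (2 * i - 1)) =
        (starRingEnd ℂ) n * c + step k - dir k (2 * (i - j) - 1) := by
      rw [← hv i]; linear_combination (step k : ℂ) * hnn
    rw [this, Complex.sub_re, Complex.add_re, dir_re, step, Complex.ofReal_re]
    have := cos_odd_le hk (i - j)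
    linarith

lemma abs_dir_im_le (hk : k = 3 ∨ k = 5) (m : ℤ) :
    |(dir k (2 * m)).im| ≤ step k * Real.sin (Real.pi / k) := by
  have hs : step k * Real.sin (Real.pi / k) = Real.cos (Real.pi / (2 * k : ℕ)) := by
    rw [step, mul_right_comm, ← Real.sin_two_mul, ← Real.cos_pi_div_two_sub]
    rcases hk with rfl | rfl
    · rw [← Real.cos_neg]; congr 1; push_cast; ring
    · congr 1; push_cast; ring
  have key : ∀ m : ℤ, (dir k (2 * m)).im ≤ step k * Real.sin (Real.pi / k) := by
    intro m
    rw [hs, dir_im, ← Real.cos_pi_div_two_sub]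
    rcases hk with rfl | rfl
    · convert! cos_odd_le (k := 2 * 3) (by norm_num) (2 - 2 * m) using 2
      push_cast; ring
    · convert! cos_odd_le (k := 2 * 5) (by norm_num) (3 - 2 * m) using 2
      push_cast; ring
  rw [abs_le]
  refine ⟨?_, key m⟩
  have := key (-m)
  rw [show 2 * -m = -(2 * m) by ring, ← conj_dir, Complex.conj_im] at this
  linarith

/-- For `k = 3` and `k = 5`, two cells sharing consecutive edges with a third one are separated
by the line through its centre and the common vertex of the two edges. -/
lemma disjoint_consecutive (hk : k = 3 ∨ k = 5) {c w : ℂ} (hw : ‖w‖ = 1) (i : ℤ) :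
    Disjoint (interior (cell k (c + step k * (w * dir k (2 * i))) (-w)))
      (interior (cell k (c + step k * (w * dir k (2 * (i + 1)))) (-w))) := by
  have hk3 : 3 ≤ k := by omega
  have hn1 : ‖w * dir k (2 * i + 1)‖ = 1 := by simp [hw]
  set m := w * dir k (2 * i + 1) with hm
  have hmm : (starRingEnd ℂ) m * m = 1 := by
    rw [← Complex.normSq_eq_conj_mul_self, Complex.normSq_eq_norm_sq, hn1]; norm_num
  have hm0 : m ≠ 0 := by intro h; rw [h] at hn1; simp at hn1
  have hv : ∀ l : ℤ, w * dir k l = m * dir k (l - (2 * i + 1)) := by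
    intro l
    rw [hm, mul_assoc, ← dir_add]; congr 2; ring
  have hre : ∀ z : ℂ, ((starRingEnd ℂ) (m * Complex.I) * z).re = ((starRingEnd ℂ) m * z).im := by
    intro z; simp; ring
  have hv2 : ∀ i' l : ℤ, (starRingEnd ℂ) m * (c + step k * (w * dir k i') + -w * dir k l) =
      (starRingEnd ℂ) m * c + step k * dir k (i' - (2 * i + 1)) - dir k (l - (2 * i + 1)) := by
    intro i' l
    rw [neg_mul, hv i', hv l]
    linear_combination (step k * dir k (i' - (2 * i + 1)) - dir k (l - (2 * i + 1))) * hmm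
  apply disjoint_interior_of_separated (mul_ne_zero hm0 Complex.I_ne_zero)
    (((starRingEnd ℂ) m * c).im)
  · apply cell_subset_of_vertices hk3 (convex_re_le _ _)
    intro j
    simp only [Set.mem_ofPred_eq]
    rw [hre, hv2]
    have h1 := abs_le.1 (abs_dir_im_le hk (j - i - 1))
    rw [show 2 * i - (2 * i + 1) = -1 by ring,
      show 2 * j - 1 - (2 * i + 1) = 2 * (j - i - 1) by ring,
      Complex.sub_im, Complex.add_im, Complex.im_ofReal_mul, dir_im (-1)]
    simp only [Int.cast_neg, Int.cast_one, mul_neg, mul_one, neg_div, Real.sin_neg]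
    linarith
  · apply cell_subset_of_vertices hk3 (convex_le_re _ _)
    intro j
    simp only [Set.mem_ofPred_eq]
    rw [hre, hv2]
    have h1 := abs_le.1 (abs_dir_im_le hk (j - i - 1))
    rw [show 2 * (i + 1) - (2 * i + 1) = 1 by ring,
      show 2 * j - 1 - (2 * i + 1) = 2 * (j - i - 1) by ring,
      Complex.sub_im, Complex.add_im, Complex.im_ofReal_mul, dir_im 1]
    simp only [Int.cast_one, mul_one]
    linarith

/-! ### Distances between centres of cells -/

lemma dir_re_lt (hk : 3 ≤ k) {m n : ℤ} (hm : 0 ≤ m) (hmn : m < n) (hn : n ≤ k) :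
    (dir k n).re < (dir k m).re := by
  have hk0 : (0 : ℝ) < k := by positivity
  have hpi := Real.pi_pos
  have h1 : (0 : ℝ) ≤ m := by exact_mod_cast hm
  have h2 : (m : ℝ) < n := by exact_mod_cast hmn
  have h3 : (n : ℝ) ≤ k := by exact_mod_cast hn
  rw [dir_re, dir_re]
  apply Real.cos_lt_cos_of_nonneg_of_le_pi (by positivity)
  · rw [div_le_iff₀ hk0]; nlinarith
  · gcongr

lemma dir_re_neg (m : ℤ) : (dir k (-m)).re = (dir k m).re := by
  rw [← conj_dir, Complex.conj_re]

lemma dir_re_inj (hk : 3 ≤ k) {m n : ℤ} (hm : 0 ≤ m) (hm' : m ≤ k) (hn : 0 ≤ n) (hn' : n ≤ k)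
    (h : (dir k m).re = (dir k n).re) : m = n := by
  rcases lt_trichotomy m n with h1 | h1 | h1
  · exact absurd h (dir_re_lt hk hm h1 hn').ne'
  · exact h1
  · exact absurd h (dir_re_lt hk hn h1 hm').ne

lemma dir_re_le_half_iff (hk : 3 ≤ k) {d : ℤ} (h0 : 0 ≤ d) (h1 : 2 * d ≤ k) :
    (dir k (2 * d)).re ≤ 1 / 2 ↔ (k : ℤ) ≤ 6 * d := by
  have hk0 : (0 : ℝ) < k := by positivity
  have hpi := Real.pi_pos
  have h2 : (0 : ℝ) ≤ d := by exact_mod_cast h0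
  have h3 : (2 * d : ℝ) ≤ k := by exact_mod_cast h1
  rw [dir_re, ← Real.cos_pi_div_three, Real.strictAntiOn_cos.le_iff_ge]
  · rw [div_le_div_iff₀ (by norm_num) hk0]
    rw [show (k : ℤ) ≤ 6 * d ↔ (k : ℝ) ≤ 6 * d by exact_mod_cast Iff.rfl]
    push_cast
    constructor <;> intro h <;> nlinarith
  · constructor
    · push_cast; positivity
    · rw [div_le_iff₀ hk0]; push_cast; nlinarith
  · constructor <;> linarith

lemma dir_re_eq_half_iff (hk : 3 ≤ k) {d : ℤ} (h0 : 0 ≤ d) (h1 : 2 * d ≤ k) :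
    (dir k (2 * d)).re = 1 / 2 ↔ (k : ℤ) = 6 * d := by
  have hk0 : (0 : ℝ) < k := by positivity
  have hpi := Real.pi_pos
  have h2 : (0 : ℝ) ≤ d := by exact_mod_cast h0
  have h3 : (2 * d : ℝ) ≤ k := by exact_mod_cast h1
  rw [dir_re, ← Real.cos_pi_div_three, Real.injOn_cos.eq_iff]
  · rw [div_eq_div_iff hk0.ne' (by norm_num)]
    rw [show (k : ℤ) = 6 * d ↔ (k : ℝ) = 6 * d by exact_mod_cast Iff.rfl]
    push_cast
    constructor <;> intro h <;> nlinarith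
  · constructor
    · push_cast; positivity
    · rw [div_le_iff₀ hk0]; push_cast; nlinarith
  · constructor <;> linarith

lemma norm_sq_dir_sub (a b : ℤ) : ‖dir k a - dir k b‖ ^ 2 = 2 - 2 * (dir k (a - b)).re := by
  have h1 := Complex.normSq_eq_norm_sq (dir k a)
  have h2 := Complex.normSq_eq_norm_sq (dir k b)
  rw [norm_dir, Complex.normSq_apply] at h1 h2
  rw [← Complex.normSq_eq_norm_sq, Complex.normSq_apply, sub_eq_add_neg a, dir_add, ← conj_dir]
  simp
  linarith

/-- The squared distance between the ends of a chain of four cells, in units of `step k`. The two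
middle cells share an edge; the first end is `p` edges away from it around the second cell and the
last end is `q` edges away from it around the third cell, counted on the same side. -/
noncomputable def endSq (k : ℕ) (p q : ℤ) : ℝ :=
  3 + 2 * (dir k (2 * p + 2 * q)).re - 2 * (dir k (2 * p)).re - 2 * (dir k (2 * q)).re

lemma norm_sq_ends (p q : ℤ) : ‖dir k (2 * p) - (1 - dir k (-(2 * q)))‖ ^ 2 = endSq k p q := by
  have h1 := Complex.normSq_eq_norm_sq (dir k (2 * p))
  have h2 := Complex.normSq_eq_norm_sq (dir k (2 * q))
  rw [norm_dir, Complex.normSq_apply] at h1 h2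
  rw [← Complex.normSq_eq_norm_sq, Complex.normSq_apply, endSq, dir_add, ← conj_dir]
  simp
  linarith

/-- With `s` and `t` half the sum and half the difference of the two bending angles, the squared
distance is `1 + 4 * cos s * (cos s - cos t)`. -/
lemma endSq_eq (p q : ℤ) :
    endSq k p q = 1 + 4 * (dir k (p + q)).re * ((dir k (p + q)).re - (dir k (p - q)).re) := by
  have h1 := Complex.normSq_eq_norm_sq (dir k p)
  have h2 := Complex.normSq_eq_norm_sq (dir k q)
  rw [norm_dir, Complex.normSq_apply] at h1 h2
  rw [endSq, two_mul p, two_mul q, sub_eq_add_neg p, dir_add, dir_add p p, dir_add q q, dir_add p q,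
    dir_add p (-q), ← conj_dir q]
  simp
  set a := (dir k p).re
  set b := (dir k p).im
  set c := (dir k q).re
  set d := (dir k q).im
  have hb : b * b = 1 - a * a := by linarith
  have hd : d * d = 1 - c * c := by linarith
  linear_combination (-2 * c * c - 6 * d * d + 2) * hb + (4 * a * a - 4) * hd

lemma step_sq_two_le (hk : 4 ≤ k) : 2 ≤ step k ^ 2 := by
  have hk4 : (4 : ℝ) ≤ k := by exact_mod_cast hk
  have hpi := Real.pi_pos
  have h : √2 / 2 ≤ Real.cos (Real.pi / k) := by
    rw [← Real.cos_pi_div_four]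
    apply Real.cos_le_cos_of_nonneg_of_le_pi (by positivity) (by linarith)
    gcongr
  have h2 : √2 ≤ step k := by rw [step]; linarith
  calc (2 : ℝ) = √2 ^ 2 := by norm_num
    _ ≤ step k ^ 2 := by gcongr

lemma step_three : step 3 = 1 := by
  rw [step]; push_cast; rw [Real.cos_pi_div_three]; norm_num

/-- A chain of cells bending too sharply returns to the position of its first cell. -/
lemma endSq_lt_one (hk : 3 ≤ k) {p q : ℤ} (hp : 0 < p) (hq : 0 < q) (h : 2 * (p + q) < k) :
    endSq k p q < 1 := by
  have h1 : 0 < (dir k (p + q)).re := by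
    rw [dir_re]
    have hk0 : (0 : ℝ) < k := by positivity
    have hpi := Real.pi_pos
    have h2 : (0 : ℝ) < (p + q : ℤ) := by exact_mod_cast (by omega : 0 < p + q)
    have h3 : (2 * (p + q : ℤ) : ℝ) < k := by exact_mod_cast h
    apply Real.cos_pos_of_mem_Ioo
    constructor
    · have : 0 < Real.pi * (p + q : ℤ) / k := by positivity
      linarith
    · rw [div_lt_div_iff₀ hk0 (by norm_num)]; nlinarith
  have h2 : (dir k (p + q)).re < (dir k (p - q)).re := by
    rcases le_total q p with h | h
    · exact dir_re_lt hk (by omega) (by omega) (by omega)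
    · rw [← dir_re_neg (p - q)]
      exact dir_re_lt hk (by omega) (by omega) (by omega)
  rw [endSq_eq]
  nlinarith [mul_pos h1 (sub_pos.2 h2)]

lemma half_le_dir_re (hk : 3 ≤ k) {d : ℤ} (h0 : 3 * d ≤ k) (h1 : -(k : ℤ) ≤ 3 * d) :
    1 / 2 ≤ (dir k d).re := by
  have hk0 : (0 : ℝ) < k := by positivity
  have hpi := Real.pi_pos
  have h2 : (3 * d : ℝ) ≤ k := by exact_mod_cast h0
  have h3 : (-k : ℝ) ≤ 3 * d := by exact_mod_cast h1
  rw [dir_re, ← Real.cos_pi_div_three, ← Real.cos_abs (Real.pi * d / k)]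
  apply Real.cos_le_cos_of_nonneg_of_le_pi (abs_nonneg _) (by linarith)
  rw [abs_le]
  constructor
  · rw [le_div_iff₀ hk0]; nlinarith
  · rw [div_le_div_iff₀ hk0 (by norm_num)]; nlinarith

/-- The ends of a chain bending to the same side by more than half a turn in total have distance at
least `2`. -/
lemma four_le_same_side (hk : 3 ≤ k) {p q : ℤ} (hp : k ≤ 6 * p) (hq : k ≤ 6 * q)
    (hp2 : 2 * p ≤ k) (hq2 : 2 * q ≤ k) (h : k < 2 * (p + q)) : 4 ≤ step k ^ 2 * endSq k p q := by
  rcases eq_or_lt_of_le hk with rfl | hk4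
  · obtain rfl : p = 1 := by push_cast at *; omega
    obtain rfl : q = 1 := by push_cast at *; omega
    rw [step_three, endSq_eq]
    have : (dir 3 (1 + 1)).re = -(1 / 2) := by
      rw [dir_re, show Real.pi * ((1 + 1 : ℤ) : ℝ) / (3 : ℕ) = Real.pi - Real.pi / 3 by
        push_cast; ring, Real.cos_pi_sub, Real.cos_pi_div_three]
    rw [this]; norm_num
  · have hk0 : (0 : ℝ) < k := by positivity
    have hpi := Real.pi_pos
    have hk4' : (4 : ℝ) ≤ k := by exact_mod_cast hk4
    -- the bends exceed half a turn by at least `2 * σ`, so it is enough that `x = sin σ` satisfies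
    -- `1 ≤ (1 - 4 * x ^ 2 * (1 - x ^ 2)) * (1 + 2 * x + 4 * x ^ 2)`
    set σ := Real.pi / (2 * k) with hσ
    have hσ0 : 0 < σ := by positivity
    have hσ1 : σ < 0.394 := by
      have := Real.pi_lt_d2
      rw [hσ, div_lt_iff₀ (by positivity)]; linarith
    set x := Real.sin σ with hx
    have hx0 : 0 < x := Real.sin_pos_of_pos_of_lt_pi hσ0
      (by linarith [Real.pi_gt_three])
    have hx1 : x < 0.394 := (Real.sin_lt hσ0).trans hσ1
    have ht := half_le_dir_re hk (d := p - q) (by omega) (by omega)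
    have hs : (dir k (p + q)).re ≤ -x := by
      have h1 : (k + 1 : ℝ) ≤ 2 * (p + q : ℤ) := by exact_mod_cast h
      have h2 : ((p + q : ℤ) : ℝ) ≤ k := by exact_mod_cast (by omega : p + q ≤ k)
      rw [dir_re, hx, ← Real.cos_pi_div_two_sub, ← Real.cos_pi_sub]
      apply Real.cos_le_cos_of_nonneg_of_le_pi
      · linarith
      · rw [div_le_iff₀ hk0]; nlinarith
      · rw [le_div_iff₀ hk0, hσ]
        have : (Real.pi - (Real.pi / 2 - Real.pi / (2 * k))) * k = Real.pi * (k + 1) / 2 := by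
          field_simp; ring
        rw [this]; nlinarith
    have hz : 1 + 2 * x + 4 * x ^ 2 ≤ endSq k p q := by
      rw [endSq_eq]
      set a := (dir k (p + q)).re
      set b := (dir k (p - q)).re
      nlinarith [mul_nonneg (by linarith : 0 ≤ -a - x) (by linarith : 0 ≤ b - 1 / 2)]
    have hstep : step k ^ 2 = 4 * (1 - 4 * x ^ 2 * (1 - x ^ 2)) := by
      have h2 : Real.pi / k = 2 * σ := by rw [hσ]; field_simp
      rw [step, h2, Real.cos_two_mul, Real.cos_sq', ← hx]; ring
    have hpos : 0 < step k ^ 2 := by have := step_pos hk; positivity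
    calc (4 : ℝ) ≤ step k ^ 2 * (1 + 2 * x + 4 * x ^ 2) := by
          rw [hstep]
          have h3 : 4 * x ^ 2 + 6 * x ^ 3 ≤ 1 := by
            have h4 : x ^ 2 ≤ 0.394 ^ 2 := by gcongr
            have h5 : x ^ 3 ≤ 0.394 ^ 3 := by gcongr
            norm_num at h4 h5; linarith
          have h6 : 0 ≤ x * (1 - (4 * x ^ 2 + 6 * x ^ 3) + 4 * x ^ 4 + 8 * x ^ 5) := by
            apply mul_nonneg hx0.le
            have : 0 ≤ 4 * x ^ 4 + 8 * x ^ 5 := by positivity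
            linarith
          linarith
      _ ≤ _ := by gcongr

/-- The ends of a chain bending to opposite sides have distance at least `2`. -/
lemma four_le_opposite (hk : 3 ≤ k) {p q : ℤ} (hp : k ≤ 6 * p) (hq : k ≤ 6 * q)
    (hp2 : 2 * p ≤ k) (hq2 : 2 * q ≤ k) : 4 ≤ step k ^ 2 * endSq k p (-q) := by
  have hk0 : (0 : ℝ) < k := by positivity
  have hpi := Real.pi_pos
  rcases eq_or_lt_of_le hk with rfl | hk4
  · obtain rfl : p = 1 := by push_cast at *; omega
    obtain rfl : q = 1 := by push_cast at *; omega
    rw [step_three, endSq_eq]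
    have : (dir 3 (1 - -1)).re = -(1 / 2) := by
      rw [dir_re, show Real.pi * ((1 - -1 : ℤ) : ℝ) / (3 : ℕ) = Real.pi - Real.pi / 3 by
        push_cast; ring, Real.cos_pi_sub, Real.cos_pi_div_three]
    rw [this]; norm_num
  · have h1 := step_sq_two_le (k := k) (by omega)
    have hs := half_le_dir_re hk (d := p + -q) (by omega) (by omega)
    have hst : 1 / 2 ≤ (dir k (p + -q)).re - (dir k (p - -q)).re := by
      rw [sub_neg_eq_add]
      have hp' : (k : ℝ) ≤ 6 * p := by exact_mod_cast hp
      have hq' : (k : ℝ) ≤ 6 * q := by exact_mod_cast hq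
      have hp2' : (2 * p : ℝ) ≤ k := by exact_mod_cast hp2
      have hq2' : (2 * q : ℝ) ≤ k := by exact_mod_cast hq2
      set t := Real.pi * (p + q : ℤ) / k with ht
      have ht1 : t ≤ Real.pi := by rw [ht, div_le_iff₀ hk0]; push_cast; nlinarith
      have ht0 : Real.pi / 3 ≤ t := by
        rw [ht, div_le_div_iff₀ (by norm_num) hk0]; push_cast; nlinarith
      rcases le_total t (2 * Real.pi / 3) with h | h
      · have h2 : Real.cos (t - Real.pi / 3) ≤ (dir k (p + -q)).re := by
          rw [dir_re, ← Real.cos_abs (Real.pi * _ / _)]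
          apply Real.cos_le_cos_of_nonneg_of_le_pi (abs_nonneg _) (by linarith)
          rw [ht, abs_le]
          have : Real.pi * (p + q : ℤ) / k - Real.pi / 3 = Real.pi * (p + q - k / 3) / k := by
            push_cast; field_simp
          rw [this, ← neg_div]
          constructor
          · push_cast
            rw [div_le_div_iff_of_pos_right hk0]; nlinarith
          · push_cast
            rw [div_le_div_iff_of_pos_right hk0]; nlinarith
        have h3 : Real.cos (t - Real.pi / 3) - Real.cos t = Real.sin (t - Real.pi / 6) := by
          rw [Real.cos_sub, Real.sin_sub, Real.cos_pi_div_three, Real.sin_pi_div_three,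
            Real.cos_pi_div_six, Real.sin_pi_div_six]; ring
        have h4 : 1 / 2 ≤ Real.sin (t - Real.pi / 6) := by
          rw [← Real.sin_pi_div_six]
          apply Real.sin_le_sin_of_le_of_le_pi_div_two <;> linarith
        rw [dir_re (p + q), ← ht]
        linarith
      · have h2 : Real.cos t ≤ 0 := by
          apply Real.cos_nonpos_of_pi_div_two_le_of_le <;> linarith
        rw [dir_re (p + q), ← ht]
        linarith
    rw [endSq_eq]
    nlinarith [mul_nonneg (by linarith : 0 ≤ (dir k (p + -q)).re - 1 / 2)
      (by linarith : 0 ≤ (dir k (p + -q)).re - (dir k (p - -q)).re - 1 / 2)]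

lemma endSq_ne_neg (hk : 3 ≤ k) {p q : ℤ} (hp : 0 < p) (hq : 0 < q) (hp2 : 2 * p < k)
    (hq2 : 2 * q < k) : endSq k p q ≠ endSq k p (-q) := by
  intro h
  have hk0 : (0 : ℝ) < k := by positivity
  have hs : ∀ {p : ℤ}, 0 < p → 2 * p < k → 0 < (dir k (2 * p)).im := by
    intro p hp hp2
    have h1 : (0 : ℝ) < p := by exact_mod_cast hp
    have h2 : (2 * p : ℝ) < k := by exact_mod_cast hp2
    have hpi := Real.pi_pos
    rw [dir_im]
    apply Real.sin_pos_of_pos_of_lt_pi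
    · push_cast; positivity
    · rw [div_lt_iff₀ hk0]; push_cast; nlinarith
  rw [endSq, endSq, show 2 * -q = -(2 * q) by ring, dir_add, dir_add, ← conj_dir] at h
  simp at h
  nlinarith [mul_pos (hs hp hp2) (hs hq hq2)]

/-- Two neighbours of a cell that are more than a sixth of a turn apart have centres at distance at
least `2`, except for consecutive neighbours of a triangle or a pentagon. -/
lemma four_le_siblings (hk : 3 ≤ k) {d : ℤ} (hd1 : k = 3 ∨ k = 5 → d ≠ 1) (hd : k < 6 * d)
    (h2d : 2 * d ≤ k) : 4 ≤ step k ^ 2 * (2 - 2 * (dir k (2 * d)).re) := by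
  have hk0 : (0 : ℝ) < k := by positivity
  have hpi := Real.pi_pos
  have hd' : (k + 1 : ℝ) ≤ 6 * d := by exact_mod_cast hd
  have h2d' : (2 * d : ℝ) ≤ k := by exact_mod_cast h2d
  have hre : 2 - 2 * (dir k (2 * d)).re = (2 * Real.sin (Real.pi * d / k)) ^ 2 := by
    rw [dir_re, show Real.pi * (2 * d : ℤ) / k = 2 * (Real.pi * d / k) by push_cast; ring,
      Real.cos_two_mul, Real.cos_sq']; ring
  rw [hre, ← mul_pow]
  have hlow : Real.sin (Real.pi / 6 + Real.pi / (6 * k)) ≤ Real.sin (Real.pi * d / k) := by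
    apply Real.sin_le_sin_of_le_of_le_pi_div_two
    · have : 0 < Real.pi / (6 * k) := by positivity
      linarith
    · rw [div_le_div_iff₀ hk0 (by norm_num)]; nlinarith
    · rw [le_div_iff₀ hk0]
      have : (Real.pi / 6 + Real.pi / (6 * k)) * k = Real.pi * (k + 1) / 6 := by field_simp
      rw [this]; nlinarith
  have hmain : 2 ≤ step k * (2 * Real.sin (Real.pi * d / k)) := by
    rcases Nat.lt_or_ge k 7 with h7 | h7
    · rcases (by omega : k = 4 ∨ k = 5 ∨ k = 6) with rfl | rfl | rfl
      · rw [step]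
        have h1 : √2 / 2 ≤ Real.sin (Real.pi * d / (4 : ℕ)) := by
          rw [← Real.sin_pi_div_four]
          apply Real.sin_le_sin_of_le_of_le_pi_div_two (by linarith)
          · rw [div_le_div_iff₀ hk0 (by norm_num)]; nlinarith
          · push_cast
            have : (1 : ℝ) ≤ d := by exact_mod_cast (by push_cast at *; omega : 1 ≤ d)
            gcongr; nlinarith
        push_cast at *
        rw [Real.cos_pi_div_four]
        have h2 : √2 * √2 = 2 := by norm_num
        nlinarith [Real.sqrt_nonneg 2]
      · obtain rfl : d = 2 := by
          have := hd1 (Or.inr rfl)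
          push_cast at *; omega
        have h1 : √3 / 2 ≤ Real.sin (Real.pi * (2 : ℤ) / (5 : ℕ)) := by
          rw [← Real.sin_pi_div_three]
          apply Real.sin_le_sin_of_le_of_le_pi_div_two <;> push_cast <;> linarith
        have h2 : √2 / 2 ≤ Real.cos (Real.pi / (5 : ℕ)) := by
          rw [← Real.cos_pi_div_four]
          apply Real.cos_le_cos_of_nonneg_of_le_pi <;> push_cast <;> linarith
        have h3 : 2 ≤ √2 * √3 := by
          rw [← Real.sqrt_mul (by norm_num)]
          exact Real.le_sqrt_of_sq_le (by norm_num)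
        have h4 := (step_pos hk).le
        rw [step] at h4 ⊢
        calc (2 : ℝ) ≤ √2 * √3 := h3
          _ = (2 * (√2 / 2)) * (2 * (√3 / 2)) := by ring
          _ ≤ _ := by gcongr
      · have hd2 : (2 : ℝ) ≤ d := by exact_mod_cast (by push_cast at *; omega : 2 ≤ d)
        have h1 : √3 / 2 ≤ Real.sin (Real.pi * d / (6 : ℕ)) := by
          rw [← Real.sin_pi_div_three]
          apply Real.sin_le_sin_of_le_of_le_pi_div_two (by linarith)
          · rw [div_le_div_iff₀ hk0 (by norm_num)]; nlinarith
          · push_cast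
            linarith [mul_le_mul_of_nonneg_left hd2 hpi.le]
        rw [step]
        push_cast at *
        rw [Real.cos_pi_div_six]
        have h2 : √3 * √3 = 3 := by norm_num
        nlinarith [Real.sqrt_nonneg 3]
    · -- `d` exceeds `k / 6` by at least `1 / 6`, which gains `√3 * θ` to first order in
      -- `θ = π / (6 * k)` and loses only `18 * θ ^ 2` from the factor `step k`
      have h7' : (7 : ℝ) ≤ k := by exact_mod_cast h7
      set θ := Real.pi / (6 * k) with hθ
      have hθ0 : 0 < θ := by positivity
      have hθ1 : θ < 0.075 := by
        have := Real.pi_lt_d2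
        rw [hθ, div_lt_iff₀ (by positivity)]; linarith
      have hst : step k = 2 * Real.cos (6 * θ) := by
        rw [step, hθ]; congr 2; field_simp
      have h1 : 1 - 18 * θ ^ 2 ≤ Real.cos (6 * θ) := by
        have := Real.one_sub_sq_div_two_le_cos (x := 6 * θ)
        linarith
      have h2 := Real.one_sub_sq_div_two_le_cos (x := θ)
      have h3 := Real.sin_gt_sub_cube hθ0
      have hsq3 : 1.73 ≤ √3 := Real.le_sqrt_of_sq_le (by norm_num)
      rw [Real.sin_add, Real.sin_pi_div_six, Real.cos_pi_div_six] at hlow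
      have h4 : 1 + 1.72 * θ - θ ^ 2 / 2 ≤ 2 * Real.sin (Real.pi * d / k) := by
        have h5 : 1.72 * θ ≤ √3 * Real.sin θ := by
          have h6 : θ ^ 3 ≤ 0.075 ^ 2 * θ := by
            have : θ ^ 2 ≤ 0.075 ^ 2 := by gcongr
            nlinarith
          have h7 : 0.998 * θ ≤ Real.sin θ := by norm_num at h6; linarith
          nlinarith
        linarith
      have h5 : 1 ≤ (1 - 18 * θ ^ 2) * (1 + 1.72 * θ - θ ^ 2 / 2) := by
        have h6 : θ ^ 2 ≤ 0.075 * θ := by nlinarith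
        have h7 : θ ^ 3 ≤ 0.075 ^ 2 * θ := by nlinarith
        have h8 : 0 ≤ θ ^ 4 := by positivity
        norm_num at h7
        nlinarith
      have h6 : 0 ≤ 1 - 18 * θ ^ 2 := by nlinarith
      rw [hst]
      have h7 : 0 ≤ 1 + 1.72 * θ - θ ^ 2 / 2 := by nlinarith
      nlinarith [mul_le_mul h1 h4 h7 (h6.trans h1)]
  nlinarith

/-! ### Neighbouring cells -/

/-- The neighbour of `cell k c w` across the edge with outer normal `w * dir k (2 * j)`. -/
noncomputable def nbr (k : ℕ) (c w : ℂ) (j : ℤ) : Set ℂ :=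
  cell k (c + step k * (w * dir k (2 * j))) (-w)

lemma nbr_zero (c w : ℂ) : nbr k c w 0 = cell k (c + step k * w) (-w) := by simp [nbr]

lemma adj_nbr (hk : 3 ≤ k) (c : ℂ) {w : ℂ} (hw : ‖w‖ = 1) (j : ℤ) :
    (cellGraph k).Adj (cell k c w) (nbr k c w j) := (adj_cell_iff hk hw).2 ⟨j, rfl⟩

lemma isCell_nbr (hk : 3 ≤ k) (c : ℂ) {w : ℂ} (hw : ‖w‖ = 1) (j : ℤ) : IsCell k (nbr k c w j) :=
  isCell_cell hk (by simpa using hw)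

lemma nbr_add_mul (hk : 3 ≤ k) (c w : ℂ) (i j : ℤ) : nbr k c w (i + j * k) = nbr k c w i := by
  rw [nbr, nbr, mul_add, dir_add, dir_two_mul_mul_self hk, mul_one]

lemma cell_neg_of_even (hk : 3 ≤ k) {j : ℤ} (hj : (k : ℤ) = 2 * j) (c w : ℂ) :
    cell k c (-w) = cell k c w := by
  have := cell_mul_dir hk c w j
  rwa [← hj, dir_self hk, mul_neg_one] at this

lemma dir_third (hk : 3 ≤ k) {d : ℤ} (hd : (k : ℤ) = 6 * d) :
    dir k (2 * d) + dir k (-(2 * d)) = 1 := by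
  have h := (dir_re_eq_half_iff hk (d := d) (by omega) (by omega)).2 hd
  apply Complex.ext
  · rw [Complex.add_re, dir_re_neg, h]; norm_num
  · rw [Complex.add_im, ← conj_dir, Complex.conj_im]; simp

/-- If `k = 6 * d`, two neighbours of a cell that are `d` edges apart are adjacent. -/
lemma adj_nbr_nbr (hk : 3 ≤ k) {d : ℤ} (hd : (k : ℤ) = 6 * d) (c : ℂ) {w : ℂ} (hw : ‖w‖ = 1)
    (i : ℤ) : (cellGraph k).Adj (nbr k c w i) (nbr k c w (i + d)) := by
  rw [nbr, adj_cell_iff hk (by simpa using hw)]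
  refine ⟨i - d, ?_⟩
  rw [nbr, neg_neg, cell_neg_of_even hk (j := 3 * d) (by linarith)]
  congr 1
  have h1 := dir_third hk hd
  rw [mul_add, mul_sub, sub_eq_add_neg, dir_add, dir_add]
  linear_combination (step k * w * dir k (2 * i)) * h1

lemma dist_nbr_centers (c w : ℂ) (hw : ‖w‖ = 1) (hk : 3 ≤ k) (i j : ℤ) :
    dist (c + step k * (w * dir k (2 * i))) (c + step k * (w * dir k (2 * j))) ^ 2 =
      step k ^ 2 * (2 - 2 * (dir k (2 * (j - i))).re) := by
  rw [dist_eq_norm, show c + step k * (w * dir k (2 * i)) - (c + step k * (w * dir k (2 * j))) =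
    step k * w * (dir k (2 * i) - dir k (2 * j)) by ring, norm_mul, norm_mul, hw, Complex.norm_real,
    Real.norm_of_nonneg (step_pos hk).le, mul_one, mul_pow, norm_sq_dir_sub, ← dir_re_neg]
  ring_nf

/-- Neighbours of a cell which are at least a sixth of a turn apart do not overlap. -/
lemma disjoint_nbr_nbr (hk : 3 ≤ k) (c : ℂ) {w : ℂ} (hw : ‖w‖ = 1) {i j : ℤ}
    (h1 : k ≤ 6 * (j - i)) (h2 : 6 * (j - i) ≤ 5 * k) :
    Disjoint (interior (nbr k c w i)) (interior (nbr k c w j)) := by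
  have hw' : ‖-w‖ = 1 := by simpa using hw
  have main : ∀ i j : ℤ, k ≤ 6 * (j - i) → 2 * (j - i) ≤ k →
      Disjoint (interior (nbr k c w i)) (interior (nbr k c w j)) := by
    intro i j h1 h2
    rcases eq_or_lt_of_le h1 with h | h
    · have := adj_nbr_nbr hk h c hw i
      rw [add_sub_cancel] at this
      exact disjoint_of_adj hk (isCell_nbr hk c hw i) this
    · by_cases h35 : (k = 3 ∨ k = 5) ∧ j - i = 1
      · obtain rfl : j = i + 1 := by omega
        exact disjoint_consecutive h35.1 hw i
      · apply disjoint_of_two_le_dist hk hw' hw'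
        have h4 := four_le_siblings hk (fun h1 h2 => h35 ⟨h1, h2⟩) h h2
        rw [← dist_nbr_centers c w hw hk] at h4
        nlinarith [dist_nonneg (x := c + step k * (w * dir k (2 * i)))
          (y := c + step k * (w * dir k (2 * j)))]
  rcases le_total (2 * (j - i)) k with h | h
  · exact main i j h1 h
  · have := main j (i + 1 * k) (by omega) (by omega)
    rw [nbr_add_mul hk] at this
    exact this.symm

/-- Nonoverlapping neighbours of a cell are at least a sixth of a turn apart. -/
lemma le_of_disjoint_nbr_nbr (hk : 3 ≤ k) {c w : ℂ} (hw : ‖w‖ = 1) {i j : ℤ}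
    (hij : i ≤ j) (h2 : 2 * (j - i) ≤ k)
    (h : Disjoint (interior (nbr k c w i)) (interior (nbr k c w j))) : k ≤ 6 * (j - i) := by
  have hw' : ‖-w‖ = 1 := by simpa using hw
  have h1 := step_le_dist_of_disjoint hk hw' hw' h
  have hs := step_pos hk
  rw [← dir_re_le_half_iff hk (by omega) h2]
  have h3 := dist_nbr_centers c w hw hk i j
  have h4 : step k ^ 2 * 1 ≤ step k ^ 2 * (2 - 2 * (dir k (2 * (j - i))).re) := by
    rw [← h3, mul_one]; gcongr
  have := le_of_mul_le_mul_left h4 (by positivity)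
  linarith

lemma dist_ends (c w : ℂ) (hw : ‖w‖ = 1) (hk : 3 ≤ k) (p q : ℤ) :
    dist (c + step k * (w * dir k (2 * p))) (c + step k * w + step k * (-w * dir k (2 * (-q)))) ^ 2 =
      step k ^ 2 * endSq k p q := by
  rw [dist_eq_norm, show c + step k * (w * dir k (2 * p)) -
    (c + step k * w + step k * (-w * dir k (2 * (-q)))) =
    step k * w * (dir k (2 * p) - (1 - dir k (2 * (-q)))) by ring, norm_mul, norm_mul, hw,
    Complex.norm_real, Real.norm_of_nonneg (step_pos hk).le, mul_one, mul_pow,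
    show 2 * (-q) = -(2 * q) by ring, norm_sq_ends]

/-- The two end cells of a chain of four cells do not overlap if they bend to the same side by
at least half a turn in total. -/
lemma disjoint_ends_same (hk : 3 ≤ k) (c : ℂ) {w : ℂ} (hw : ‖w‖ = 1) {p q : ℤ} (hp : k ≤ 6 * p)
    (hq : k ≤ 6 * q) (hp2 : 2 * p ≤ k) (hq2 : 2 * q ≤ k) (h : k ≤ 2 * (p + q)) :
    Disjoint (interior (nbr k c w p)) (interior (nbr k (c + step k * w) (-w) (-q))) := by
  have hw' : ‖-w‖ = 1 := by simpa using hw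
  rcases eq_or_lt_of_le h with h | h
  · -- the four cells form a rhombus
    apply disjoint_of_adj hk (isCell_nbr hk c hw p)
    rw [nbr, adj_cell_iff hk hw']
    refine ⟨p + q, ?_⟩
    rw [nbr, ← h, dir_self hk]
    congr 1
    have h2 : dir k (2 * -q) = -dir k (2 * p) := by
      rw [show 2 * -q = 2 * p + -k by linarith, dir_add]
      have := dir_mul_dir_neg (k := k) k
      rw [dir_self hk] at this
      linear_combination -dir k (2 * p) * this
    rw [h2]; ring
  · apply disjoint_of_two_le_dist hk hw' (by simpa using hw)
    have h4 := four_le_same_side hk hp hq hp2 hq2 h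
    rw [← dist_ends c w hw hk] at h4
    nlinarith [dist_nonneg (x := c + step k * (w * dir k (2 * p)))
      (y := c + step k * w + step k * (-w * dir k (2 * (-q))))]

lemma disjoint_ends_opposite (hk : 3 ≤ k) (c : ℂ) {w : ℂ} (hw : ‖w‖ = 1) {p q : ℤ}
    (hp : k ≤ 6 * p) (hq : k ≤ 6 * q) (hp2 : 2 * p ≤ k) (hq2 : 2 * q ≤ k) :
    Disjoint (interior (nbr k c w p)) (interior (nbr k (c + step k * w) (-w) (- -q))) := by
  have hw' : ‖-w‖ = 1 := by simpa using hw
  apply disjoint_of_two_le_dist hk hw' (by simpa using hw)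
  have h4 := four_le_opposite hk hp hq hp2 hq2
  rw [← dist_ends c w hw hk] at h4
  nlinarith [dist_nonneg (x := c + step k * (w * dir k (2 * p)))
    (y := c + step k * w + step k * (-w * dir k (2 * (- -q))))]

lemma le_of_disjoint_ends (hk : 3 ≤ k) {c w : ℂ} (hw : ‖w‖ = 1) {p q : ℤ} (hp : 0 < p)
    (hq : 0 < q)
    (h : Disjoint (interior (nbr k c w p)) (interior (nbr k (c + step k * w) (-w) (-q)))) :
    k ≤ 2 * (p + q) := by
  by_contra! hlt
  have h1 := step_le_dist_of_disjoint hk (by simpa using hw) (by simpa using hw) h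
  have hs := step_pos hk
  have h2 := endSq_lt_one hk hp hq hlt
  have h3 := dist_ends c w hw hk p q
  have h4 : step k ^ 2 * 1 ≤ step k ^ 2 * endSq k p q := by
    rw [← h3, mul_one]; gcongr
  have := le_of_mul_le_mul_left h4 (by positivity)
  linarith

/-! ### Polyominoes with four cells -/

lemma interior_nonempty (hk : 3 ≤ k) {C : Set ℂ} (hC : IsCell k C) : (interior C).Nonempty := by
  obtain ⟨c, w, hw, rfl⟩ := exists_cell_eq hC
  refine ⟨c, interior_maximal (Metric.ball_subset_closedBall.trans (closedBall_subset_cell hk hw))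
    Metric.isOpen_ball (Metric.mem_ball_self ?_)⟩
  have := step_pos hk; positivity

lemma ne_of_disjoint_interior (hk : 3 ≤ k) {C D : Set ℂ} (hC : IsCell k C)
    (h : Disjoint (interior C) (interior D)) : C ≠ D := by
  rintro rfl
  exact (interior_nonempty hk hC).ne_empty (disjoint_self.1 h)

lemma isPolyomino_of_tree (hk : 3 ≤ k) {A B C D : Set ℂ} (hA : IsCell k A) (hB : IsCell k B)
    (hC : IsCell k C) (hD : IsCell k D)
    (dAB : Disjoint (interior A) (interior B)) (dAC : Disjoint (interior A) (interior C))
    (dAD : Disjoint (interior A) (interior D)) (dBC : Disjoint (interior B) (interior C))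
    (dBD : Disjoint (interior B) (interior D)) (dCD : Disjoint (interior C) (interior D))
    (h1 : (cellGraph k).Adj A B) (h2 : (cellGraph k).Adj A C ∨ (cellGraph k).Adj B C)
    (h3 : (cellGraph k).Adj A D ∨ (cellGraph k).Adj B D ∨ (cellGraph k).Adj C D) :
    IsPolyomino k 4 {A, B, C, D} where
  encard_eq := by
    have hAB := ne_of_disjoint_interior hk hA dAB
    have hAC := ne_of_disjoint_interior hk hA dAC
    have hAD := ne_of_disjoint_interior hk hA dAD
    have hBC := ne_of_disjoint_interior hk hB dBC
    have hBD := ne_of_disjoint_interior hk hB dBD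
    have hCD := ne_of_disjoint_interior hk hC dCD
    rw [Set.encard_insert_of_notMem (by simp [hAB, hAC, hAD]),
      Set.encard_insert_of_notMem (by simp [hBC, hBD]),
      Set.encard_insert_of_notMem (by simp [hCD]), Set.encard_singleton]
    norm_num
  isCell := by
    rintro X (rfl | rfl | rfl | rfl) <;> assumption
  nonoverlapping := by
    rintro X (rfl | rfl | rfl | rfl) Y (rfl | rfl | rfl | rfl) hne <;>
      first | exact absurd rfl hne | assumption | (apply Disjoint.symm; assumption)
  connected := by
    set G := (cellGraph k).induce {A, B, C, D}
    have mA : A ∈ ({A, B, C, D} : Set (Set ℂ)) := by simp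
    have mB : B ∈ ({A, B, C, D} : Set (Set ℂ)) := by simp
    have mC : C ∈ ({A, B, C, D} : Set (Set ℂ)) := by simp
    have mD : D ∈ ({A, B, C, D} : Set (Set ℂ)) := by simp
    have hadj : ∀ {X Y} (hX : X ∈ ({A, B, C, D} : Set (Set ℂ))) (hY : Y ∈ ({A, B, C, D} : Set (Set ℂ))),
        (cellGraph k).Adj X Y → G.Reachable ⟨X, hX⟩ ⟨Y, hY⟩ := by
      intro X Y hX hY h
      exact SimpleGraph.Adj.reachable (G := G) (SimpleGraph.induce_adj.2 h)
    have rB : G.Reachable ⟨A, mA⟩ ⟨B, mB⟩ := hadj mA mB h1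
    have rC : G.Reachable ⟨A, mA⟩ ⟨C, mC⟩ := by
      rcases h2 with h | h
      · exact hadj mA mC h
      · exact rB.trans (hadj mB mC h)
    have rD : G.Reachable ⟨A, mA⟩ ⟨D, mD⟩ := by
      rcases h3 with h | h | h
      · exact hadj mA mD h
      · exact rB.trans (hadj mB mD h)
      · exact rC.trans (hadj mC mD h)
    rw [SimpleGraph.connected_iff_exists_forall_reachable]
    refine ⟨⟨A, mA⟩, ?_⟩
    rintro ⟨X, rfl | rfl | rfl | rfl⟩
    · exact SimpleGraph.Reachable.refl _
    · exact rB
    · exact rC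
    · exact rD

lemma IsPolyomino.exists_adj {n : ℕ} {P S : Set (Set ℂ)} (hP : IsPolyomino k n P) {A : Set ℂ}
    (hS : S ⊆ P) (hA : A ∈ S) (hlt : S.encard < n) :
    ∃ X ∈ S, ∃ Y ∈ P, Y ∉ S ∧ (cellGraph k).Adj X Y := by
  have : ∃ Y ∈ P, Y ∉ S := by
    by_contra! h
    have := Set.encard_le_encard (show P ⊆ S from h)
    rw [hP.encard_eq] at this
    exact absurd hlt (not_lt.2 this)
  obtain ⟨Y, hY, hYS⟩ := this
  obtain ⟨p⟩ := hP.connected.preconnected ⟨A, hS hA⟩ ⟨Y, hY⟩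
  obtain ⟨d, -, h1, h2⟩ := p.exists_boundary_dart {X | X.1 ∈ S} hA hYS
  exact ⟨d.fst.1, h1, d.snd.1, d.snd.2, h2, d.adj⟩

/-- A polyomino with four cells contains a star or a chain. -/
lemma IsPolyomino.exists_tree {P : Set (Set ℂ)} (hP : IsPolyomino k 4 P) :
    ∃ A B C D, P = {A, B, C, D} ∧ A ≠ B ∧ A ≠ C ∧ A ≠ D ∧ B ≠ C ∧ B ≠ D ∧ C ≠ D ∧
      (cellGraph k).Adj A B ∧ (((cellGraph k).Adj A C ∧ (cellGraph k).Adj A D) ∨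
        ((cellGraph k).Adj B C ∧ (cellGraph k).Adj C D)) := by
  have hfin : P.Finite := by
    apply Set.finite_of_encard_eq_coe hP.encard_eq
  have done : ∀ {A B C D}, A ∈ P → B ∈ P → C ∈ P → D ∈ P → A ≠ B → A ≠ C → A ≠ D → B ≠ C →
      B ≠ D → C ≠ D → P = {A, B, C, D} := by
    intro A B C D mA mB mC mD hAB hAC hAD hBC hBD hCD
    symm
    apply (Set.toFinite ({A, B, C, D} : Set (Set ℂ))).eq_of_subset_of_encard_le
    · rintro X (rfl | rfl | rfl | rfl) <;> assumption
    · rw [hP.encard_eq, Set.encard_insert_of_notMem (by simp [hAB, hAC, hAD]),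
        Set.encard_insert_of_notMem (by simp [hBC, hBD]),
        Set.encard_insert_of_notMem (by simp [hCD]), Set.encard_singleton]
      norm_num
  obtain ⟨⟨A, mA⟩⟩ := hP.connected.nonempty
  obtain ⟨X, rfl, B, mB, hB, hAB⟩ := hP.exists_adj (S := {A}) (by simpa using mA) rfl
    (by rw [Set.encard_singleton]; norm_num)
  have hXB : X ≠ B := fun h => hB h.symm
  obtain ⟨Y, hY, C, mC, hC, hYC⟩ := hP.exists_adj (S := {X, B}) (A := X)
    (by rintro Z (rfl | rfl) <;> assumption) (by simp)
    (by rw [Set.encard_pair hXB]; norm_num)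
  -- after renaming, the first three cells form a chain `A`, `B`, `C`
  obtain ⟨A, B, mA, mB, hAB, hBC, hCA, hCB⟩ : ∃ A B, A ∈ P ∧ B ∈ P ∧ (cellGraph k).Adj A B ∧
      (cellGraph k).Adj B C ∧ C ≠ A ∧ C ≠ B := by
    simp only [Set.mem_insert_iff, Set.mem_singleton_iff, not_or] at hC
    rcases hY with rfl | rfl
    · exact ⟨B, Y, mB, mA, hAB.symm, hYC, hC.2, hC.1⟩
    · exact ⟨X, Y, mA, mB, hAB, hYC, hC.1, hC.2⟩
  obtain ⟨Z, hZ, D, mD, hD, hZD⟩ := hP.exists_adj (S := {A, B, C}) (A := A)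
    (by rintro Z (rfl | rfl | rfl) <;> assumption) (by simp)
    (by
      rw [Set.encard_insert_of_notMem (by simp [hAB.ne, hCA.symm]), Set.encard_pair hCB.symm]
      norm_num)
  simp only [Set.mem_insert_iff, Set.mem_singleton_iff, not_or] at hD
  obtain ⟨hDA, hDB, hDC⟩ := hD
  have hAB' := hAB.ne
  rcases hZ with rfl | rfl | rfl
  · exact ⟨D, Z, B, C, done mD mA mB mC hDA hDB hDC hAB' hCA.symm hCB.symm, hDA, hDB, hDC, hAB',
      hCA.symm, hCB.symm, hZD.symm, Or.inr ⟨hAB, hBC⟩⟩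
  · exact ⟨Z, A, C, D, done mB mA mC mD hAB'.symm hCB.symm (Ne.symm hDB) hCA.symm (Ne.symm hDA)
      (Ne.symm hDC), hAB'.symm, hCB.symm, Ne.symm hDB, hCA.symm, Ne.symm hDA, Ne.symm hDC, hAB.symm,
      Or.inl ⟨hBC, hZD⟩⟩
  · exact ⟨A, B, Z, D, done mA mB mC mD hAB' hCA.symm (Ne.symm hDA) hCB.symm (Ne.symm hDB)
      (Ne.symm hDC), hAB', hCA.symm, Ne.symm hDA, hCB.symm, Ne.symm hDB, Ne.symm hDC, hAB,
      Or.inr ⟨hBC, hZD⟩⟩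

/-! ### Stars and chains -/

/-- Congruence of sets of cells. -/
def Congruent (P Q : Set (Set ℂ)) : Prop := ∃ e : ℂ ≃ᵢ ℂ, Q = (fun C : Set ℂ => e '' C) '' P

lemma Congruent.symm {P Q : Set (Set ℂ)} : Congruent P Q → Congruent Q P := by
  rintro ⟨e, rfl⟩
  exact ⟨e.symm, by simp only [Set.image_image, IsometryEquiv.symm_apply_apply, Set.image_id']⟩

lemma Congruent.trans {P Q R : Set (Set ℂ)} : Congruent P Q → Congruent Q R → Congruent P R := by
  rintro ⟨e, rfl⟩ ⟨f, rfl⟩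
  refine ⟨e.trans f, ?_⟩
  simp only [Set.image_image]
  rfl

/-- A cell and three neighbours of it; going around the cell, the second neighbour is `g` edges
after the first one, and the third one `h` edges after the second. -/
noncomputable def star (k : ℕ) (g h : ℤ) : Set (Set ℂ) :=
  {cell k 0 1, nbr k 0 1 0, nbr k 0 1 g, nbr k 0 1 (g + h)}

/-- A chain of four cells. Going around the second cell, the first cell is `p` edges away from the
third one; going around the third cell, the fourth cell is `q` edges away from the second one,
counted with the opposite orientation. -/
noncomputable def chain (k : ℕ) (p q : ℤ) : Set (Set ℂ) :=
  {nbr k 0 1 p, cell k 0 1, nbr k 0 1 0, nbr k (step k) (-1) (-q)}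

lemma nbr_mul_dir (hk : 3 ≤ k) (c w : ℂ) (i j : ℤ) :
    nbr k c (w * dir k (2 * i)) j = nbr k c w (i + j) := by
  rw [nbr, nbr, ← neg_mul, cell_mul_dir hk, mul_assoc, ← dir_add, mul_add]

lemma image_nbr_rotation (hk : 3 ≤ k) {e : ℂ ≃ᵢ ℂ} {a b : ℂ} (he : ∀ z, e z = a * z + b)
    (c w : ℂ) (j : ℤ) : e '' nbr k c w j = nbr k (a * c + b) (a * w) j := by
  rw [nbr, nbr, image_cell_rotation hk he]
  congr 1 <;> ring

lemma image_nbr_conj (hk : 3 ≤ k) {e : ℂ ≃ᵢ ℂ} (he : ∀ z, e z = 1 * (starRingEnd ℂ) z + 0)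
    (c w : ℂ) (j : ℤ) :
    e '' nbr k c w j = nbr k ((starRingEnd ℂ) c) ((starRingEnd ℂ) w) (-j) := by
  rw [nbr, nbr, image_cell_reflection hk he, show 2 * -j = -(2 * j) by ring, ← conj_dir]
  simp

lemma congruent_star (hk : 3 ≤ k) (c : ℂ) {w : ℂ} (hw : ‖w‖ = 1) (i j l : ℤ) :
    Congruent {cell k c w, nbr k c w i, nbr k c w j, nbr k c w l} (star k (j - i) (l - j)) := by
  have hww : (starRingEnd ℂ) w * w = 1 := by
    rw [← Complex.normSq_eq_conj_mul_self, Complex.normSq_eq_norm_sq, hw]; norm_num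
  obtain ⟨e, he⟩ := exists_rotation (a := (starRingEnd ℂ) w * dir k (2 * -i)) (by simp [hw])
    (-((starRingEnd ℂ) w * dir k (2 * -i) * c))
  have h1 : (starRingEnd ℂ) w * dir k (2 * -i) * c + -((starRingEnd ℂ) w * dir k (2 * -i) * c) = 0 := by
    ring
  have h2 : (starRingEnd ℂ) w * dir k (2 * -i) * w = 1 * dir k (2 * -i) := by
    linear_combination (dir k (2 * -i)) * hww
  refine ⟨e, ?_⟩
  simp only [Set.image_insert_eq, Set.image_singleton, image_cell_rotation hk he,
    image_nbr_rotation hk he, h1, h2, cell_mul_dir hk, nbr_mul_dir hk, star]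
  ring_nf

/-- With `star_swap`, this shows that the order of the three gaps of a star is irrelevant. -/
lemma star_rotate (hk : 3 ≤ k) (g h : ℤ) : Congruent (star k g h) (star k h (k - g - h)) := by
  have := congruent_star hk 0 (w := 1) (by simp) g (g + h) (0 + 1 * k)
  rw [nbr_add_mul hk] at this
  convert! this using 2
  · rw [star]
    ext X; simp only [Set.mem_insert_iff, Set.mem_singleton_iff]; tauto
  · ring
  · ring

lemma star_swap (hk : 3 ≤ k) (g h : ℤ) : Congruent (star k g h) (star k h g) := by
  obtain ⟨e, he⟩ := exists_reflection (a := 1) (by simp) 0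
  have h1 : Congruent (star k g h)
      {cell k 0 1, nbr k 0 1 (-(g + h)), nbr k 0 1 (-g), nbr k 0 1 0} := by
    refine ⟨e, ?_⟩
    simp only [star, Set.image_insert_eq, Set.image_singleton, image_cell_reflection hk he,
      image_nbr_conj hk he, map_zero, map_one, mul_zero, mul_one, add_zero, neg_zero]
    ext X; simp only [Set.mem_insert_iff, Set.mem_singleton_iff]; tauto
  refine h1.trans ?_
  convert! congruent_star hk 0 (w := 1) (by simp) (-(g + h)) (-g) 0 using 2 <;> ring

lemma congruent_chain (hk : 3 ≤ k) (c : ℂ) {w : ℂ} (hw : ‖w‖ = 1) (p q : ℤ) :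
    Congruent {nbr k c w p, cell k c w, nbr k c w 0, nbr k (c + step k * w) (-w) (-q)}
      (chain k p q) := by
  have hww : (starRingEnd ℂ) w * w = 1 := by
    rw [← Complex.normSq_eq_conj_mul_self, Complex.normSq_eq_norm_sq, hw]; norm_num
  obtain ⟨e, he⟩ := exists_rotation (a := (starRingEnd ℂ) w) (by simp [hw])
    (-((starRingEnd ℂ) w * c))
  have h1 : (starRingEnd ℂ) w * c + -((starRingEnd ℂ) w * c) = 0 := by ring
  have h2 : (starRingEnd ℂ) w * (c + step k * w) + -((starRingEnd ℂ) w * c) = step k := by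
    linear_combination (step k : ℂ) * hww
  have h3 : (starRingEnd ℂ) w * -w = -1 := by linear_combination -hww
  refine ⟨e, ?_⟩
  simp only [Set.image_insert_eq, Set.image_singleton, image_cell_rotation hk he,
    image_nbr_rotation hk he, h1, h2, h3, hww, chain]

lemma chain_neg (hk : 3 ≤ k) (p q : ℤ) : Congruent (chain k p q) (chain k (-p) (-q)) := by
  obtain ⟨e, he⟩ := exists_reflection (a := 1) (by simp) 0
  refine ⟨e, ?_⟩
  simp only [chain, Set.image_insert_eq, Set.image_singleton, image_cell_reflection hk he,
    image_nbr_conj hk he, map_zero, map_one, mul_zero, mul_one, add_zero, neg_zero, map_neg,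
    Complex.conj_ofReal]

lemma chain_reverse (hk : 3 ≤ k) (p q : ℤ) : Congruent (chain k p q) (chain k (-q) (-p)) := by
  have := congruent_chain hk (step k) (w := -1) (by simp) (-q) (-p)
  rw [nbr_zero] at this
  simp only [neg_neg, mul_neg, mul_one, add_neg_cancel] at this
  convert! this using 1
  rw [chain, nbr_zero]
  simp only [zero_add, mul_one]
  ext X; simp only [Set.mem_insert_iff, Set.mem_singleton_iff]; tauto

lemma chain_swap (hk : 3 ≤ k) (p q : ℤ) : Congruent (chain k p q) (chain k q p) := by
  have := (chain_reverse hk p q).trans (chain_neg hk _ _)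
  simpa using this

/-- A bend by exactly half a turn has no side. -/
lemma chain_half (hk : 3 ≤ k) {p q : ℤ} (hq : 2 * q = k) : chain k p (-q) = chain k p q := by
  rw [chain, chain, show - -q = -q + 1 * k by linarith, nbr_add_mul hk]

/-! ### Every polyomino with four cells is a star or a chain -/

lemma isPolyomino_star (hk : 3 ≤ k) {g h : ℤ} (hg : k ≤ 6 * g) (hh : k ≤ 6 * h)
    (hl : k ≤ 6 * (k - g - h)) : IsPolyomino k 4 (star k g h) := by
  have h1 : ‖(1 : ℂ)‖ = 1 := by simp
  have adj := adj_nbr hk 0 h1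
  have hc := isCell_cell hk (c := 0) h1
  have hn := isCell_nbr hk 0 h1
  apply isPolyomino_of_tree hk hc (hn 0) (hn g) (hn (g + h)) (disjoint_of_adj hk hc (adj 0))
    (disjoint_of_adj hk hc (adj g)) (disjoint_of_adj hk hc (adj (g + h))) _ _ _ (adj 0)
    (Or.inl (adj g)) (Or.inl (adj (g + h)))
  all_goals apply disjoint_nbr_nbr hk 0 h1 <;> omega

lemma isPolyomino_chain (hk : 3 ≤ k) {p q : ℤ}
    (hp : Disjoint (interior (nbr k 0 1 p)) (interior (nbr k 0 1 0)))
    (hq : Disjoint (interior (nbr k (step k) (-1) 0)) (interior (nbr k (step k) (-1) (-q))))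
    (h : Disjoint (interior (nbr k 0 1 p)) (interior (nbr k (step k) (-1) (-q)))) :
    IsPolyomino k 4 (chain k p q) := by
  have h1 : ‖(1 : ℂ)‖ = 1 := by simp
  have h1' : ‖(-1 : ℂ)‖ = 1 := by simp
  have adj := adj_nbr hk 0 h1
  have adj' := adj_nbr hk (step k) h1' (-q)
  have hB : nbr k (step k) (-1) 0 = cell k 0 1 := by rw [nbr_zero]; simp
  have hC : nbr k 0 1 0 = cell k (step k) (-1) := by rw [nbr_zero]; simp
  rw [← hC] at adj'
  rw [hB] at hq
  have hc := isCell_cell hk (c := 0) h1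
  have hn := isCell_nbr hk 0 h1
  exact isPolyomino_of_tree hk (hn p) hc (hn 0) (isCell_nbr hk (step k) h1' (-q))
    (disjoint_of_adj hk hc (adj p)).symm hp h (disjoint_of_adj hk hc (adj 0)) hq
    (disjoint_of_adj hk (hn 0) adj') (adj p).symm (Or.inr (adj 0)) (Or.inr (Or.inr adj'))

lemma isPolyomino_chain_same (hk : 3 ≤ k) {p q : ℤ} (hp : k ≤ 6 * p) (hq : k ≤ 6 * q)
    (hp2 : 2 * p ≤ k) (hq2 : 2 * q ≤ k) (h : k ≤ 2 * (p + q)) : IsPolyomino k 4 (chain k p q) := by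
  have h1 : ‖(1 : ℂ)‖ = 1 := by simp
  have h1' : ‖(-1 : ℂ)‖ = 1 := by simp
  apply isPolyomino_chain hk
  · exact (disjoint_nbr_nbr hk 0 h1 (by omega) (by omega)).symm
  · exact (disjoint_nbr_nbr hk _ h1' (by omega) (by omega)).symm
  · have := disjoint_ends_same hk 0 h1 hp hq hp2 hq2 h
    simpa using this

lemma isPolyomino_chain_opposite (hk : 3 ≤ k) {p q : ℤ} (hp : k ≤ 6 * p) (hq : k ≤ 6 * q)
    (hp2 : 2 * p ≤ k) (hq2 : 2 * q ≤ k) : IsPolyomino k 4 (chain k p (-q)) := by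
  have h1 : ‖(1 : ℂ)‖ = 1 := by simp
  have h1' : ‖(-1 : ℂ)‖ = 1 := by simp
  apply isPolyomino_chain hk
  · exact (disjoint_nbr_nbr hk 0 h1 (by omega) (by omega)).symm
  · exact disjoint_nbr_nbr hk _ h1' (by omega) (by omega)
  · have := disjoint_ends_opposite hk 0 h1 hp hq hp2 hq2
    simpa using this

/-- `P` is congruent to a star, with the three gaps between consecutive neighbours sorted. -/
def IsStar (k : ℕ) (P : Set (Set ℂ)) : Prop :=
  ∃ g h : ℤ, k ≤ 6 * g ∧ g ≤ h ∧ h ≤ k - g - h ∧ Congruent P (star k g h)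

/-- `P` is congruent to a chain in normal form. The inequality `k < 6 * x` excludes chains with
three mutually adjacent cells, which are stars as well. -/
def IsChain (k : ℕ) (P : Set (Set ℂ)) : Prop :=
  ∃ x y : ℤ, k < 6 * x ∧ x ≤ y ∧ ((2 * y ≤ k ∧ k ≤ 2 * (x + y) ∧ Congruent P (chain k x y)) ∨
    (2 * y < k ∧ Congruent P (chain k x (-y))))

lemma gap_le (hk : 3 ≤ k) {c w : ℂ} (hw : ‖w‖ = 1) {i j : ℤ} (hij : i ≤ j)
    (h : Disjoint (interior (nbr k c w i)) (interior (nbr k c w j))) : k ≤ 6 * (j - i) := by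
  by_cases h2 : 2 * (j - i) ≤ k
  · exact le_of_disjoint_nbr_nbr hk hw hij h2 h
  · omega

lemma nbr_emod (hk : 3 ≤ k) (c w : ℂ) (j : ℤ) : nbr k c w (j % k) = nbr k c w j := by
  rw [← nbr_add_mul hk c w (j % k) (j / k)]
  congr 1
  have := Int.emod_add_mul_ediv j k
  linarith

lemma isStar_of_gaps (hk : 3 ≤ k) {P : Set (Set ℂ)} {g h l : ℤ} (hs : g + h + l = k)
    (hg : k ≤ 6 * g) (hh : k ≤ 6 * h) (hl : k ≤ 6 * l) (hP : Congruent P (star k g h)) :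
    IsStar k P := by
  have r : ∀ {a b c : ℤ}, a + b + c = k → Congruent (star k a b) (star k b c) := by
    intro a b c h
    have := star_rotate hk a b
    rwa [show (k : ℤ) - a - b = c by linarith] at this
  have s := fun a b : ℤ => star_swap hk a b
  rcases le_total g h with h1 | h1 <;> rcases le_total h l with h2 | h2 <;>
    rcases le_total g l with h3 | h3
  · exact ⟨g, h, hg, h1, by omega, hP⟩
  · exact ⟨g, h, hg, h1, by omega, hP⟩
  · exact ⟨g, l, hg, h3, by omega, (hP.trans (s g h)).trans (r (by omega))⟩
  · exact ⟨l, g, hl, h3, by omega, (hP.trans (r hs)).trans (r (by omega))⟩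
  · exact ⟨h, g, hh, h1, by omega, hP.trans (s g h)⟩
  · exact ⟨h, l, hh, h2, by omega, hP.trans (r hs)⟩
  · exact ⟨l, h, hl, h2, by omega, (hP.trans (r hs)).trans (s h l)⟩
  · exact ⟨l, h, hl, h2, by omega, (hP.trans (r hs)).trans (s h l)⟩

lemma isStar_of_nbrs (hk : 3 ≤ k) (c : ℂ) {w : ℂ} (hw : ‖w‖ = 1) (i j l : ℤ)
    (hij : Disjoint (interior (nbr k c w i)) (interior (nbr k c w j)))
    (hil : Disjoint (interior (nbr k c w i)) (interior (nbr k c w l)))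
    (hjl : Disjoint (interior (nbr k c w j)) (interior (nbr k c w l))) :
    IsStar k {cell k c w, nbr k c w i, nbr k c w j, nbr k c w l} := by
  have hw' : ‖w * dir k (2 * i)‖ = 1 := by simp [hw]
  have main : ∀ a b : ℤ, 0 ≤ a → a ≤ b → b < k → ∀ w : ℂ, ‖w‖ = 1 →
      Disjoint (interior (nbr k c w 0)) (interior (nbr k c w a)) →
      Disjoint (interior (nbr k c w 0)) (interior (nbr k c w b)) →
      Disjoint (interior (nbr k c w a)) (interior (nbr k c w b)) →
      IsStar k {cell k c w, nbr k c w 0, nbr k c w a, nbr k c w b} := by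
    intro a b ha hab hb w hw h1 h2 h3
    have g1 := gap_le hk hw ha h1
    have g2 := gap_le hk hw hab h3
    rw [← nbr_add_mul hk c w 0 1] at h2
    have g3 := gap_le hk hw (by omega) h2.symm
    exact isStar_of_gaps hk (g := a - 0) (h := b - a) (l := k - b) (by ring) g1 g2 (by linarith)
      (congruent_star hk c hw 0 a b)
  have e0 : nbr k c w i = nbr k c (w * dir k (2 * i)) 0 := by rw [nbr_mul_dir hk, add_zero]
  have e1 : ∀ j, nbr k c w j = nbr k c (w * dir k (2 * i)) ((j - i) % k) := by
    intro j; rw [nbr_emod hk, nbr_mul_dir hk]; congr 1; ring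
  rw [← cell_mul_dir hk c w i, e0, e1 j, e1 l]
  rw [e0, e1 j] at hij
  rw [e0, e1 l] at hil
  rw [e1 j, e1 l] at hjl
  have hk0 : (k : ℤ) ≠ 0 := by omega
  have hk1 : (0 : ℤ) < k := by omega
  rcases le_total ((j - i) % k) ((l - i) % k) with h | h
  · exact main _ _ (Int.emod_nonneg _ hk0) h (Int.emod_lt_of_pos _ hk1) _ hw' hij hil hjl
  · have := main _ _ (Int.emod_nonneg _ hk0) h (Int.emod_lt_of_pos _ hk1) _ hw' hil hij hjl.symm
    convert! this using 1
    ext X; simp only [Set.mem_insert_iff, Set.mem_singleton_iff]; tauto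

lemma isStar_of_adj (hk : 3 ≤ k) {A B C D : Set ℂ} (hA : IsCell k A)
    (hBC : Disjoint (interior B) (interior C)) (hBD : Disjoint (interior B) (interior D))
    (hCD : Disjoint (interior C) (interior D)) (hB : (cellGraph k).Adj A B)
    (hC : (cellGraph k).Adj A C) (hD : (cellGraph k).Adj A D) : IsStar k {A, B, C, D} := by
  obtain ⟨c, w, hw, rfl⟩ := exists_cell_eq hA
  obtain ⟨i, rfl⟩ := (adj_cell_iff hk hw).1 hB
  obtain ⟨j, rfl⟩ := (adj_cell_iff hk hw).1 hC
  obtain ⟨l, rfl⟩ := (adj_cell_iff hk hw).1 hD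
  exact isStar_of_nbrs hk c hw i j l hBC hBD hCD

lemma isChain_of_congruent (hk : 3 ≤ k) {P : Set (Set ℂ)} {p q : ℤ} (hp : k < 6 * |p|)
    (hq : k < 6 * |q|) (hp2 : 2 * |p| ≤ k) (hq2 : 2 * |q| ≤ k)
    (hpos : 0 < p → 0 < q → k ≤ 2 * (p + q)) (hneg : p < 0 → q < 0 → k ≤ 2 * (-q + -p))
    (hP : Congruent P (chain k p q)) : IsChain k P := by
  have same : ∀ p q : ℤ, 0 < p → 0 < q → k < 6 * p → k < 6 * q → 2 * p ≤ k → 2 * q ≤ k →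
      k ≤ 2 * (p + q) → Congruent P (chain k p q) → IsChain k P := by
    intro p q h1 h2 h3 h4 h5 h6 h7 h8
    rcases le_total p q with h | h
    · exact ⟨p, q, h3, h, Or.inl ⟨h6, h7, h8⟩⟩
    · exact ⟨q, p, h4, h, Or.inl ⟨h5, by omega, h8.trans (chain_swap hk p q)⟩⟩
  have opp : ∀ p q : ℤ, 0 < p → 0 < q → k < 6 * p → k < 6 * q → 2 * p ≤ k → 2 * q ≤ k →
      Congruent P (chain k p (-q)) → IsChain k P := by
    have aux : ∀ p q : ℤ, p ≤ q → k < 6 * p → 2 * q ≤ k → Congruent P (chain k p (-q)) →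
        IsChain k P := by
      intro p q h1 h2 h3 h4
      rcases eq_or_lt_of_le h3 with h | h
      · rw [chain_half hk h] at h4
        exact ⟨p, q, h2, h1, Or.inl ⟨h3, by omega, h4⟩⟩
      · exact ⟨p, q, h2, h1, Or.inr ⟨h, h4⟩⟩
    intro p q h1 h2 h3 h4 h5 h6 h7
    rcases le_total p q with h | h
    · exact aux p q h h3 h6 h7
    · have := h7.trans (chain_reverse hk p (-q))
      rw [neg_neg] at this
      exact aux q p h h4 h5 this
  rcases lt_trichotomy p 0 with h1 | rfl | h1
  · rw [abs_of_neg h1] at hp hp2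
    have hP' := hP.trans (chain_neg hk p q)
    rcases lt_trichotomy q 0 with h2 | rfl | h2
    · rw [abs_of_neg h2] at hq hq2
      exact same (-p) (-q) (by omega) (by omega) hp hq hp2 hq2 (by have := hneg h1 h2; omega) hP'
    · simp at hq; omega
    · rw [abs_of_pos h2] at hq hq2
      exact opp (-p) q (by omega) h2 hp hq hp2 hq2 hP'
  · simp at hp; omega
  · rw [abs_of_pos h1] at hp hp2
    rcases lt_trichotomy q 0 with h2 | rfl | h2
    · rw [abs_of_neg h2] at hq hq2
      exact opp p (-q) h1 (by omega) hp hq hp2 hq2 (by rwa [neg_neg])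
    · simp at hq; omega
    · rw [abs_of_pos h2] at hq hq2
      exact same p q h1 h2 hp hq hp2 hq2 (hpos h1 h2) hP

lemma exists_balanced (hk : 3 ≤ k) (j : ℤ) : ∃ i m : ℤ, j = i + m * k ∧ 2 * |i| ≤ k := by
  have h0 : 0 ≤ j % (k : ℤ) := Int.emod_nonneg _ (by omega)
  have h1 : j % (k : ℤ) < k := Int.emod_lt_of_pos _ (by omega)
  have h2 := Int.emod_add_mul_ediv j k
  by_cases h : 2 * (j % k) ≤ k
  · exact ⟨j % k, j / k, by linarith, by rwa [abs_of_nonneg h0]⟩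
  · refine ⟨j % k - k, j / k + 1, by linarith, ?_⟩
    rw [abs_of_neg (by omega)]; omega

lemma gap_abs_le (hk : 3 ≤ k) {c w : ℂ} (hw : ‖w‖ = 1) {i : ℤ}
    (h : Disjoint (interior (nbr k c w i)) (interior (nbr k c w 0))) : k ≤ 6 * |i| := by
  rcases le_total 0 i with hi | hi
  · have := gap_le hk hw hi h.symm
    rw [abs_of_nonneg hi]; linarith
  · have := gap_le hk hw hi h
    rw [abs_of_nonpos hi]; linarith

lemma adj_nbr_zero (hk : 3 ≤ k) (c : ℂ) {w : ℂ} (hw : ‖w‖ = 1) {i : ℤ} (h : (k : ℤ) = 6 * |i|) :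
    (cellGraph k).Adj (nbr k c w i) (nbr k c w 0) := by
  rcases le_total 0 i with hi | hi
  · rw [abs_of_nonneg hi] at h
    have := adj_nbr_nbr hk h c hw 0
    rw [zero_add] at this
    exact this.symm
  · rw [abs_of_nonpos hi] at h
    have := adj_nbr_nbr hk h c hw i
    rwa [add_neg_cancel] at this

/-- Nonoverlapping chains without three mutually adjacent cells have a normal form. -/
lemma isChain_of_nbrs (hk : 3 ≤ k) (c : ℂ) {v : ℂ} (hv : ‖v‖ = 1) (p' q' : ℤ)
    (dAC : Disjoint (interior (nbr k c v p')) (interior (nbr k c v 0)))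
    (dBD : Disjoint (interior (cell k c v)) (interior (nbr k (c + step k * v) (-v) q')))
    (dAD : Disjoint (interior (nbr k c v p')) (interior (nbr k (c + step k * v) (-v) q')))
    (hAC : ¬ (cellGraph k).Adj (nbr k c v p') (nbr k c v 0))
    (hBD : ¬ (cellGraph k).Adj (nbr k (c + step k * v) (-v) q') (cell k c v)) :
    IsChain k {nbr k c v p', cell k c v, nbr k c v 0, nbr k (c + step k * v) (-v) q'} := by
  have hv' : ‖-v‖ = 1 := by simpa using hv
  obtain ⟨p, mp, hpp, hp2⟩ := exists_balanced hk p'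
  obtain ⟨q, mq, hqq, hq2⟩ := exists_balanced hk (-q')
  have hp' : nbr k c v p' = nbr k c v p := by rw [hpp, nbr_add_mul hk]
  have hq' : nbr k (c + step k * v) (-v) q' = nbr k (c + step k * v) (-v) (-q) := by
    rw [show q' = -q + (-mq) * k by linarith, nbr_add_mul hk]
  have hB0 : cell k c v = nbr k (c + step k * v) (-v) 0 := by
    rw [nbr_zero]; congr 1 <;> ring
  rw [hp'] at dAC dAD hAC ⊢
  rw [hq'] at dBD dAD hBD ⊢
  rw [hB0] at dBD hBD
  have hp := gap_abs_le hk hv dAC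
  have hq := gap_abs_le hk hv' dBD.symm
  have hp3 : (k : ℤ) ≠ 6 * |p| := fun h => hAC (adj_nbr_zero hk c hv h)
  have hq3 : (k : ℤ) ≠ 6 * |-q| := fun h => hBD (adj_nbr_zero hk _ hv' h)
  rw [abs_neg] at hq hq3
  refine isChain_of_congruent hk (lt_of_le_of_ne hp hp3) (lt_of_le_of_ne hq hq3) hp2 hq2 ?_ ?_
    (congruent_chain hk c hv p q)
  · intro h1 h2
    exact le_of_disjoint_ends hk hv h1 h2 dAD
  · intro h1 h2
    -- read the chain backwards
    have hc : c + step k * v + step k * -v = c := by ring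
    apply le_of_disjoint_ends hk hv' (c := c + step k * v) (neg_pos.2 h2) (neg_pos.2 h1)
    rw [neg_neg p, hc, neg_neg v]
    exact dAD.symm

lemma isChain_of_adj (hk : 3 ≤ k) {A B C D : Set ℂ} (cB : IsCell k B)
    (dAC : Disjoint (interior A) (interior C)) (dBD : Disjoint (interior B) (interior D))
    (dAD : Disjoint (interior A) (interior D))
    (hAB : (cellGraph k).Adj A B) (hBC : (cellGraph k).Adj B C) (hCD : (cellGraph k).Adj C D)
    (hAC : ¬ (cellGraph k).Adj A C) (hBD : ¬ (cellGraph k).Adj D B) : IsChain k {A, B, C, D} := by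
  obtain ⟨c, w, hw, rfl⟩ := exists_cell_eq cB
  obtain ⟨m, rfl⟩ := (adj_cell_iff hk hw).1 hBC
  -- turn the second cell so that the third one is its neighbour number zero
  obtain ⟨v, hv, hvB, hvC⟩ : ∃ v : ℂ, ‖v‖ = 1 ∧ cell k c w = cell k c v ∧
      cell k (c + step k * (w * dir k (2 * m))) (-w) = nbr k c v 0 :=
    ⟨w * dir k (2 * m), by simp [hw], (cell_mul_dir hk c w m).symm, by
      rw [nbr_mul_dir hk, add_zero, nbr]⟩
  rw [hvB] at hAB dBD hBD ⊢
  rw [hvC] at hCD dAC hAC ⊢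
  obtain ⟨p', rfl⟩ := (adj_cell_iff hk hv).1 hAB.symm
  rw [nbr_zero] at hCD
  obtain ⟨q', rfl⟩ := (adj_cell_iff hk (by simpa using hv)).1 hCD
  exact isChain_of_nbrs hk c hv p' q' dAC dBD dAD hAC hBD

lemma isStar_or_isChain (hk : 3 ≤ k) {P : Set (Set ℂ)} (hP : IsPolyomino k 4 P) :
    IsStar k P ∨ IsChain k P := by
  obtain ⟨A, B, C, D, rfl, nAB, nAC, nAD, nBC, nBD, nCD, hAB, h⟩ := hP.exists_tree
  have mA : A ∈ ({A, B, C, D} : Set (Set ℂ)) := by simp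
  have mB : B ∈ ({A, B, C, D} : Set (Set ℂ)) := by simp
  have mC : C ∈ ({A, B, C, D} : Set (Set ℂ)) := by simp
  have mD : D ∈ ({A, B, C, D} : Set (Set ℂ)) := by simp
  have dAB := hP.nonoverlapping A mA B mB nAB
  have dAC := hP.nonoverlapping A mA C mC nAC
  have dAD := hP.nonoverlapping A mA D mD nAD
  have dBC := hP.nonoverlapping B mB C mC nBC
  have dBD := hP.nonoverlapping B mB D mD nBD
  have dCD := hP.nonoverlapping C mC D mD nCD
  have cA := hP.isCell A mA
  have cB := hP.isCell B mB
  have cC := hP.isCell C mC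
  rcases h with ⟨hAC, hAD⟩ | ⟨hBC, hCD⟩
  · exact Or.inl (isStar_of_adj hk cA dBC dBD dCD hAB hAC hAD)
  by_cases hAC : (cellGraph k).Adj C A
  · left
    convert! isStar_of_adj hk cC dAB dAD dBD hAC hBC.symm hCD using 1
    ext X; simp only [Set.mem_insert_iff, Set.mem_singleton_iff]; tauto
  by_cases hBD : (cellGraph k).Adj B D
  · left
    convert! isStar_of_adj hk cB dAC dAD dCD hAB.symm hBC hBD using 1
    ext X; simp only [Set.mem_insert_iff, Set.mem_singleton_iff]; tauto
  exact Or.inr (isChain_of_adj hk cB dAC dBD dAD hAB hBC hCD (fun h => hAC h.symm)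
    fun h => hBD h.symm)

/-! ### Telling stars and chains apart by the distances of the centres -/

/-- The symmetric function on pairs from four points with the given values off the diagonal. -/
def pairTable (a01 a02 a03 a12 a13 a23 : ℝ) : Fin 4 → Fin 4 → ℝ :=
  ![![0, a01, a02, a03], ![a01, 0, a12, a13], ![a02, a12, 0, a23], ![a03, a13, a23, 0]]

/-- `P` consists of cells whose centres have the squared distances `M`, in units of `step k`. -/
def HasDistances (k : ℕ) (P : Set (Set ℂ)) (M : Fin 4 → Fin 4 → ℝ) : Prop :=
  ∃ c w : Fin 4 → ℂ, (∀ i, ‖w i‖ = 1) ∧ P = Set.range (fun i => cell k (c i) (w i)) ∧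
    ∀ i j, dist (c i) (c j) ^ 2 = step k ^ 2 * M i j

/-- Isometries map centres to centres, so congruent sets of cells have the same table of distances
up to relabelling. -/
lemma HasDistances.exists_perm (hk : 3 ≤ k) {P P' : Set (Set ℂ)} {M M' : Fin 4 → Fin 4 → ℝ}
    (hP : HasDistances k P M) (hP' : HasDistances k P' M') (h : Congruent P P') :
    ∃ σ : Fin 4 → Fin 4, ∀ i j, M i j = M' (σ i) (σ j) := by
  obtain ⟨c, w, hw, rfl, hM⟩ := hP
  obtain ⟨c', w', hw', rfl, hM'⟩ := hP'
  obtain ⟨e, he⟩ := h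
  have h1 : ∀ i, ∃ j, e (c i) = c' j := by
    intro i
    obtain ⟨v, hv, hev⟩ := exists_image_cell hk e (c i) (hw i)
    have : cell k (e (c i)) v ∈ Set.range fun i => cell k (c' i) (w' i) := by
      rw [he]
      exact ⟨_, ⟨i, rfl⟩, hev⟩
    obtain ⟨j, hj⟩ := this
    exact ⟨j, (center_eq_of_cell_eq hk (hw' j) hv hj).symm⟩
  choose σ hσ using h1
  refine ⟨σ, fun i j => ?_⟩
  have h2 := hM' (σ i) (σ j)
  rw [← hσ, ← hσ, e.dist_eq, hM] at h2
  have := step_pos hk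
  exact mul_left_cancel₀ (by positivity) h2

/-- The squared distance between the centres of two neighbours of a cell that are `d` edges apart,
in units of `step k`. -/
noncomputable def chordSq (k : ℕ) (d : ℤ) : ℝ := 2 - 2 * (dir k (2 * d)).re

lemma chordSq_sub (hk : 3 ≤ k) (d : ℤ) : chordSq k (k - d) = chordSq k d := by
  rw [chordSq, chordSq, show 2 * ((k : ℤ) - d) = -(2 * d) + 2 * (1 * k) by ring, dir_add,
    dir_two_mul_mul_self hk, mul_one, dir_re_neg]

lemma chordSq_inj (hk : 3 ≤ k) {d d' : ℤ} (h0 : 0 ≤ d) (h1 : 2 * d ≤ k) (h0' : 0 ≤ d')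
    (h1' : 2 * d' ≤ k) (h : chordSq k d = chordSq k d') : d = d' := by
  have := dir_re_inj hk (by omega) h1 (by omega) h1'
    (show (dir k (2 * d)).re = (dir k (2 * d')).re by unfold chordSq at h; linarith)
  omega

lemma chordSq_eq_or (hk : 3 ≤ k) {d d' : ℤ} (h0 : 0 ≤ d) (h1 : d ≤ k) (h0' : 0 ≤ d')
    (h1' : d' ≤ k) (h : chordSq k d = chordSq k d') : d = d' ∨ d = k - d' := by
  rcases le_total (2 * d) k with h2 | h2 <;> rcases le_total (2 * d') k with h3 | h3
  · exact Or.inl (chordSq_inj hk h0 h2 h0' h3 h)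
  · rw [← chordSq_sub hk d'] at h
    exact Or.inr (chordSq_inj hk h0 h2 (by omega) (by omega) h)
  · rw [← chordSq_sub hk d] at h
    have := chordSq_inj hk (by omega) (by omega) h0' h3 h
    right; omega
  · rw [← chordSq_sub hk d, ← chordSq_sub hk d'] at h
    have := chordSq_inj hk (by omega) (by omega) (by omega) (by omega) h
    left; omega

lemma one_lt_chordSq (hk : 3 ≤ k) {d : ℤ} (h0 : k < 6 * d) (h1 : 2 * d ≤ k) :
    1 < chordSq k d := by
  have h2 := (dir_re_le_half_iff hk (by omega) h1).2 h0.le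
  have h3 := (dir_re_eq_half_iff hk (by omega) h1).not.2 h0.ne
  have := lt_of_le_of_ne h2 h3
  unfold chordSq; linarith

lemma chordSq_pos (hk : 3 ≤ k) {d : ℤ} (h0 : 0 < d) (h1 : d < k) : 0 < chordSq k d := by
  have main : ∀ d : ℤ, 0 < d → 2 * d ≤ k → 0 < chordSq k d := by
    intro d h0 h1
    have := dir_re_lt hk le_rfl (by omega : 0 < 2 * d) h1
    rw [dir_zero, Complex.one_re] at this
    unfold chordSq; linarith
  rcases le_total (2 * d) k with h | h
  · exact main d h0 h
  · rw [← chordSq_sub hk]; exact main _ (by omega) (by omega)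

lemma dist_center_nbr (hk : 3 ≤ k) (c : ℂ) {w : ℂ} (hw : ‖w‖ = 1) (j : ℤ) :
    dist c (c + step k * (w * dir k (2 * j))) ^ 2 = step k ^ 2 * 1 := by
  rw [dist_self_add_right, norm_mul, norm_mul, norm_dir, hw, Complex.norm_real,
    Real.norm_of_nonneg (step_pos hk).le]; ring

lemma hasDistances_of_pairs {P : Set (Set ℂ)} {c0 c1 c2 c3 w0 w1 w2 w3 : ℂ}
    (h0 : ‖w0‖ = 1) (h1 : ‖w1‖ = 1) (h2 : ‖w2‖ = 1) (h3 : ‖w3‖ = 1)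
    (hP : P = {cell k c0 w0, cell k c1 w1, cell k c2 w2, cell k c3 w3})
    {a b c d e f : ℝ} (h01 : dist c0 c1 ^ 2 = step k ^ 2 * a) (h02 : dist c0 c2 ^ 2 = step k ^ 2 * b)
    (h03 : dist c0 c3 ^ 2 = step k ^ 2 * c) (h12 : dist c1 c2 ^ 2 = step k ^ 2 * d)
    (h13 : dist c1 c3 ^ 2 = step k ^ 2 * e) (h23 : dist c2 c3 ^ 2 = step k ^ 2 * f) :
    HasDistances k P (pairTable a b c d e f) := by
  refine ⟨![c0, c1, c2, c3], ![w0, w1, w2, w3], ?_, ?_, ?_⟩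
  · intro i; fin_cases i <;> simpa
  · rw [hP]
    ext X
    simp only [Set.mem_insert_iff, Set.mem_singleton_iff, Set.mem_range, Fin.exists_fin_succ,
      Fin.exists_fin_zero]
    simp [eq_comm]
  · intro i j
    fin_cases i <;> fin_cases j <;> simp [pairTable] <;>
      first | assumption | (rw [dist_comm]; assumption)

lemma hasDistances_star (hk : 3 ≤ k) (g h : ℤ) : HasDistances k (star k g h)
    (pairTable 1 1 1 (chordSq k g) (chordSq k (g + h)) (chordSq k h)) := by
  have h1 : ‖(1 : ℂ)‖ = 1 := by simp
  have h1' : ‖(-1 : ℂ)‖ = 1 := by simp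
  have d1 := dist_center_nbr hk 0 h1
  have d2 := dist_nbr_centers 0 1 h1 hk
  refine hasDistances_of_pairs h1 h1' h1' h1' rfl (d1 _) (d1 _) (d1 _) ?_ ?_ ?_
  · rw [d2, chordSq, sub_zero]
  · rw [d2, chordSq, sub_zero]
  · rw [d2, chordSq, add_sub_cancel_left]

lemma hasDistances_chain (hk : 3 ≤ k) (p q : ℤ) : HasDistances k (chain k p q)
    (pairTable 1 (chordSq k p) (endSq k p q) 1 (chordSq k q) 1) := by
  have h1 : ‖(1 : ℂ)‖ = 1 := by simp
  have h1' : ‖(-1 : ℂ)‖ = 1 := by simp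
  have d1 := dist_center_nbr hk 0 h1
  have d2 := dist_nbr_centers 0 1 h1 hk
  have d3 := dist_center_nbr hk (step k) h1'
  have d4 := dist_nbr_centers (step k) (-1) h1' hk
  have d5 := dist_ends 0 1 h1 hk p q
  have e1 : (step k : ℂ) = 0 + step k * (1 * dir k (2 * 0)) := by simp
  have e2 : (0 : ℂ) = step k + step k * (-1 * dir k (2 * 0)) := by simp
  refine hasDistances_of_pairs h1' h1 h1' (by simp) rfl ?_ ?_ ?_ (d1 _) ?_ ?_
  · rw [dist_comm]; exact d1 _
  · rw [d2, chordSq, zero_sub, mul_neg, dir_re_neg]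
  · rw [← d5]; simp
  · conv_lhs => rw [e2]
    rw [d4, chordSq, sub_zero, mul_neg, dir_re_neg]
  · rw [← e1]; exact d3 _

/-- A relabelling cannot turn the distances of a star into those of a chain: vertex of a
chain without triangles is adjacent to all the others. -/
lemma pairTable_star_ne_chain {x y z x' y' z' : ℝ} (hx : 0 < x) (hy : 0 < y) (hz : 0 < z)
    (hx' : x' ≠ 1) (hy' : y' ≠ 1) {σ : Fin 4 → Fin 4}
    (h : ∀ i j, pairTable 1 1 1 x z y i j = pairTable 1 x' z' 1 y' 1 (σ i) (σ j)) : False := by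
  have h01 := h 0 1
  have h02 := h 0 2
  have h03 := h 0 3
  have h12 := h 1 2
  have h13 := h 1 3
  have h23 := h 2 3
  generalize σ 0 = s0 at *
  generalize σ 1 = s1 at *
  generalize σ 2 = s2 at *
  generalize σ 3 = s3 at *
  clear h
  have hx0 := hx.ne'
  have hy0 := hy.ne'
  have hz0 := hz.ne'
  have a1 := hx'.symm
  have a2 := hy'.symm
  clear hx hy hz
  fin_cases s0 <;> fin_cases s1 <;> simp [pairTable, *] at h01 <;>
    fin_cases s2 <;> simp [pairTable, *] at h02 h12 <;> fin_cases s3 <;>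
    simp_all [pairTable]

/-- The distances between the three leaves of a star are determined up to order. -/
lemma pairTable_star {x y z x' y' z' : ℝ} (hx : 0 < x) (hy : 0 < y) (hz : 0 < z)
    {σ : Fin 4 → Fin 4}
    (h : ∀ i j, pairTable 1 1 1 x z y i j = pairTable 1 1 1 x' z' y' (σ i) (σ j)) :
    (x = x' ∧ y = y' ∧ z = z') ∨ (x = x' ∧ y = z' ∧ z = y') ∨ (x = y' ∧ y = x' ∧ z = z') ∨
      (x = y' ∧ y = z' ∧ z = x') ∨ (x = z' ∧ y = x' ∧ z = y') ∨ (x = z' ∧ y = y' ∧ z = x') := by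
  have h01 := h 0 1
  have h02 := h 0 2
  have h03 := h 0 3
  have h12 := h 1 2
  have h13 := h 1 3
  have h23 := h 2 3
  generalize σ 0 = s0 at *
  generalize σ 1 = s1 at *
  generalize σ 2 = s2 at *
  generalize σ 3 = s3 at *
  clear h
  have hx0 := hx.ne'
  have hy0 := hy.ne'
  have hz0 := hz.ne'
  clear hx hy hz
  fin_cases s0 <;> fin_cases s1 <;> simp [pairTable] at h01 <;>
    fin_cases s2 <;> simp [pairTable] at h02 h12 <;> fin_cases s3 <;>
    simp [pairTable] at h03 h13 h23 <;> simp_all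

/-- The distances of a chain determine its bends up to order, and the distance of its ends. This
includes the case `z = 1`, in which the adjacent pairs form a cycle. -/
lemma pairTable_chain {x y z x' y' z' : ℝ} (hz : 0 < z) (hx0 : 0 < x) (hy0 : 0 < y)
    (hx : x ≠ 1) (hy : y ≠ 1) (hx' : x' ≠ 1) (hy' : y' ≠ 1)
    {σ : Fin 4 → Fin 4}
    (h : ∀ i j, pairTable 1 x z 1 y 1 i j = pairTable 1 x' z' 1 y' 1 (σ i) (σ j)) :
    z = z' ∧ ((x = x' ∧ y = y') ∨ (x = y' ∧ y = x')) := by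
  have h01 := h 0 1
  have h02 := h 0 2
  have h03 := h 0 3
  have h12 := h 1 2
  have h13 := h 1 3
  have h23 := h 2 3
  generalize σ 0 = s0 at *
  generalize σ 1 = s1 at *
  generalize σ 2 = s2 at *
  generalize σ 3 = s3 at *
  clear h
  replace hz := hz.ne'
  replace hx0 := hx0.ne'
  replace hy0 := hy0.ne'
  have a1 := hx'.symm
  have a2 := hy'.symm
  fin_cases s0 <;> fin_cases s1 <;> simp [pairTable, *] at h01 <;>
    fin_cases s2 <;> simp [pairTable, *] at h02 h12 <;> fin_cases s3 <;>
    simp [pairTable, *] at h03 h13 h23 <;> simp_all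

lemma endSq_pos_same (hk : 3 ≤ k) {p q : ℤ} (hp : k < 6 * p) (hq : k < 6 * q) (hp2 : 2 * p ≤ k)
    (hq2 : 2 * q ≤ k) (h : k ≤ 2 * (p + q)) : 0 < endSq k p q := by
  have h1 : ‖(1 : ℂ)‖ = 1 := by simp
  have h2 := step_le_dist_of_disjoint hk (by simp) (by simp)
    (disjoint_ends_same hk 0 h1 hp.le hq.le hp2 hq2 h)
  have hs := step_pos hk
  have h3 := dist_ends 0 1 h1 hk p q
  exact pos_of_mul_pos_right (h3 ▸ pow_pos (hs.trans_le h2) 2) (sq_nonneg _)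

lemma endSq_pos_opposite (hk : 3 ≤ k) {p q : ℤ} (hp : k < 6 * p) (hq : k < 6 * q)
    (hp2 : 2 * p ≤ k) (hq2 : 2 * q ≤ k) : 0 < endSq k p (-q) :=
  pos_of_mul_pos_right (by linarith [four_le_opposite hk hp.le hq.le hp2 hq2])
    (sq_nonneg (step k))

lemma star_inj (hk : 3 ≤ k) {g h g' h' : ℤ} (hg : k ≤ 6 * g) (hgh : g ≤ h) (hl : g + 2 * h ≤ k)
    (hg' : k ≤ 6 * g') (hgh' : g' ≤ h') (hl' : g' + 2 * h' ≤ k)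
    (hc : Congruent (star k g h) (star k g' h')) : g = g' ∧ h = h' := by
  obtain ⟨σ, hσ⟩ := (hasDistances_star hk g h).exists_perm hk (hasDistances_star hk g' h') hc
  have e : ∀ {d d' : ℤ}, 0 ≤ d → d ≤ k → 0 ≤ d' → d' ≤ k → chordSq k d = chordSq k d' →
      d = d' ∨ d = k - d' := fun h0 h1 h2 h3 => chordSq_eq_or hk h0 h1 h2 h3
  rcases pairTable_star (chordSq_pos hk (by omega) (by omega)) (chordSq_pos hk (by omega) (by omega))
    (chordSq_pos hk (by omega) (by omega)) hσ with h | h | h | h | h | h <;>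
  · obtain ⟨e1, e2, e3⟩ := h
    have e1 := e (by omega) (by omega) (by omega) (by omega) e1
    have e2 := e (by omega) (by omega) (by omega) (by omega) e2
    have e3 := e (by omega) (by omega) (by omega) (by omega) e3
    omega

lemma not_congruent_star_chain (hk : 3 ≤ k) {g h p q : ℤ} (hg : k ≤ 6 * g) (hgh : g ≤ h)
    (hl : g + 2 * h ≤ k) (hp : chordSq k p ≠ 1) (hq : chordSq k q ≠ 1) :
    ¬ Congruent (star k g h) (chain k p q) := by
  intro hc
  obtain ⟨σ, hσ⟩ := (hasDistances_star hk g h).exists_perm hk (hasDistances_chain hk p q) hc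
  exact pairTable_star_ne_chain (chordSq_pos hk (by omega) (by omega))
    (chordSq_pos hk (by omega) (by omega)) (chordSq_pos hk (by omega) (by omega)) hp hq hσ

lemma chordSq_neg (d : ℤ) : chordSq k (-d) = chordSq k d := by
  rw [chordSq, chordSq, mul_neg, dir_re_neg]

lemma chain_inj (hk : 3 ≤ k) {x y x' y' : ℤ} {q q' : ℤ} (hx : k < 6 * x) (hxy : x ≤ y)
    (hy : 2 * y ≤ k) (hx' : k < 6 * x') (hxy' : x' ≤ y') (hy' : 2 * y' ≤ k) (hq : q = y ∨ q = -y)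
    (hq' : q' = y' ∨ q' = -y') (hz : 0 < endSq k x q)
    (hc : Congruent (chain k x q) (chain k x' q')) :
    x = x' ∧ y = y' ∧ endSq k x q = endSq k x' q' := by
  obtain ⟨σ, hσ⟩ := (hasDistances_chain hk x q).exists_perm hk (hasDistances_chain hk x' q') hc
  have e : chordSq k q = chordSq k y := by rcases hq with rfl | rfl <;> simp [chordSq_neg]
  have e' : chordSq k q' = chordSq k y' := by rcases hq' with rfl | rfl <;> simp [chordSq_neg]
  rw [e, e'] at hσ
  have l1 := one_lt_chordSq hk hx (by omega)
  have l2 := one_lt_chordSq hk (d := y) (by omega) hy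
  have l3 := one_lt_chordSq hk hx' (by omega)
  have l4 := one_lt_chordSq hk (d := y') (by omega) hy'
  obtain ⟨h1, h2⟩ := pairTable_chain hz (by linarith) (by linarith) l1.ne' l2.ne' l3.ne' l4.ne' hσ
  rcases h2 with ⟨h3, h4⟩ | ⟨h3, h4⟩
  · exact ⟨chordSq_inj hk (by omega) (by omega) (by omega) (by omega) h3,
      chordSq_inj hk (by omega) (by omega) (by omega) (by omega) h4, h1⟩
  · have h3 := chordSq_inj hk (by omega) (by omega) (by omega) (by omega) h3
    have h4 := chordSq_inj hk (by omega) (by omega) (by omega) (by omega) h4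
    exact ⟨by omega, by omega, h1⟩

/-! ### The classification -/

/-- The two smallest gaps of a star, in increasing order. -/
def starCodes (k : ℕ) : Finset (ℕ × ℕ) :=
  (Finset.range (k + 1) ×ˢ Finset.range (k + 1)).filter fun c =>
    k ≤ 6 * c.1 ∧ c.1 ≤ c.2 ∧ c.1 + 2 * c.2 ≤ k

/-- The parameters of chains whose ends lie on the same side. -/
def sameCodes (k : ℕ) : Finset (ℕ × ℕ) :=
  (Finset.range (k + 1) ×ˢ Finset.range (k + 1)).filter fun c =>
    k < 6 * c.1 ∧ c.1 ≤ c.2 ∧ 2 * c.2 ≤ k ∧ k ≤ 2 * (c.1 + c.2)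

/-- The parameters of chains whose ends lie on opposite sides. -/
def oppositeCodes (k : ℕ) : Finset (ℕ × ℕ) :=
  (Finset.range (k + 1) ×ˢ Finset.range (k + 1)).filter fun c =>
    k < 6 * c.1 ∧ c.1 ≤ c.2 ∧ 2 * c.2 < k

lemma mem_starCodes {c : ℕ × ℕ} :
    c ∈ starCodes k ↔ k ≤ 6 * c.1 ∧ c.1 ≤ c.2 ∧ c.1 + 2 * c.2 ≤ k := by
  simp only [starCodes, Finset.mem_filter, Finset.mem_product, Finset.mem_range]
  omega

lemma mem_sameCodes {c : ℕ × ℕ} :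
    c ∈ sameCodes k ↔ k < 6 * c.1 ∧ c.1 ≤ c.2 ∧ 2 * c.2 ≤ k ∧ k ≤ 2 * (c.1 + c.2) := by
  simp only [sameCodes, Finset.mem_filter, Finset.mem_product, Finset.mem_range]
  omega

lemma mem_oppositeCodes {c : ℕ × ℕ} :
    c ∈ oppositeCodes k ↔ k < 6 * c.1 ∧ c.1 ≤ c.2 ∧ 2 * c.2 < k := by
  simp only [oppositeCodes, Finset.mem_filter, Finset.mem_product, Finset.mem_range]
  omega

/-- The polyomino with a given code. -/
noncomputable def polyominoOfCode (hk : 3 ≤ k) :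
    starCodes k ⊕ sameCodes k ⊕ oppositeCodes k → {P : Set (Set ℂ) // IsPolyomino k 4 P}
  | .inl c => ⟨star k c.1.1 c.1.2, by
      have := mem_starCodes.1 c.2
      exact isPolyomino_star hk (by omega) (by omega) (by omega)⟩
  | .inr (.inl c) => ⟨chain k c.1.1 c.1.2, by
      have := mem_sameCodes.1 c.2
      exact isPolyomino_chain_same hk (by omega) (by omega) (by omega) (by omega) (by omega)⟩
  | .inr (.inr c) => ⟨chain k c.1.1 (-c.1.2), by
      have := mem_oppositeCodes.1 c.2
      exact isPolyomino_chain_opposite hk (by omega) (by omega) (by omega) (by omega)⟩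

lemma polyominoOfCode_injective (hk : 3 ≤ k)
    {c d : starCodes k ⊕ sameCodes k ⊕ oppositeCodes k}
    (h : Congruent (polyominoOfCode hk c).1 (polyominoOfCode hk d).1) : c = d := by
  have ne1 : ∀ {x : ℤ}, k < 6 * x → 2 * x ≤ k → chordSq k x ≠ 1 :=
    fun h1 h2 => (one_lt_chordSq hk h1 h2).ne'
  have mixed : ∀ (c : sameCodes k) (d : oppositeCodes k),
      ¬ Congruent (chain k c.1.1 c.1.2) (chain k d.1.1 (-d.1.2)) := by
    rintro ⟨⟨x, y⟩, hc⟩ ⟨⟨x', y'⟩, hd⟩ h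
    rw [mem_sameCodes] at hc
    rw [mem_oppositeCodes] at hd
    simp only at hc hd h
    obtain ⟨h1, h2, h3⟩ := chain_inj hk (y := y) (y' := y') (by omega) (by omega) (by omega)
      (by omega) (by omega) (by omega) (Or.inl rfl) (Or.inr rfl)
      (endSq_pos_same hk (by omega) (by omega) (by omega) (by omega) (by omega)) h
    rw [← h1, ← h2] at h3
    exact endSq_ne_neg hk (by omega) (by omega) (by omega) (by omega) h3
  rcases c with c | c | c <;> rcases d with d | d | d
  · obtain ⟨⟨x, y⟩, hc⟩ := c
    obtain ⟨⟨x', y'⟩, hd⟩ := d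
    have hc' := mem_starCodes.1 hc
    have hd' := mem_starCodes.1 hd
    simp only at hc' hd'
    change Congruent (star k x y) (star k x' y') at h
    obtain ⟨h1, h2⟩ := star_inj hk (by omega) (by omega) (by omega) (by omega) (by omega)
      (by omega) h
    norm_cast at h1 h2
    subst h1 h2
    rfl
  · have hc := mem_starCodes.1 c.2
    have hd := mem_sameCodes.1 d.2
    exact absurd h (not_congruent_star_chain hk (by omega) (by omega) (by omega)
      (ne1 (by omega) (by omega)) (ne1 (by omega) (by omega)))
  · have hc := mem_starCodes.1 c.2
    have hd := mem_oppositeCodes.1 d.2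
    exact absurd h (not_congruent_star_chain hk (by omega) (by omega) (by omega)
      (ne1 (by omega) (by omega)) (by rw [chordSq_neg]; exact ne1 (by omega) (by omega)))
  · have hd := mem_starCodes.1 d.2
    have hc := mem_sameCodes.1 c.2
    exact absurd h.symm (not_congruent_star_chain hk (by omega) (by omega) (by omega)
      (ne1 (by omega) (by omega)) (ne1 (by omega) (by omega)))
  · obtain ⟨⟨x, y⟩, hc⟩ := c
    obtain ⟨⟨x', y'⟩, hd⟩ := d
    have hc' := mem_sameCodes.1 hc
    have hd' := mem_sameCodes.1 hd
    simp only at hc' hd'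
    change Congruent (chain k x y) (chain k x' y') at h
    obtain ⟨h1, h2, -⟩ := chain_inj hk (y := y) (y' := y') (by omega) (by omega) (by omega)
      (by omega) (by omega) (by omega) (Or.inl rfl) (Or.inl rfl)
      (endSq_pos_same hk (by omega) (by omega) (by omega) (by omega) (by omega)) h
    norm_cast at h1 h2
    subst h1 h2
    rfl
  · exact absurd h (mixed c d)
  · have hd := mem_starCodes.1 d.2
    have hc := mem_oppositeCodes.1 c.2
    exact absurd h.symm (not_congruent_star_chain hk (by omega) (by omega) (by omega)
      (ne1 (by omega) (by omega)) (by rw [chordSq_neg]; exact ne1 (by omega) (by omega)))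
  · exact absurd h.symm (mixed d c)
  · obtain ⟨⟨x, y⟩, hc⟩ := c
    obtain ⟨⟨x', y'⟩, hd⟩ := d
    have hc' := mem_oppositeCodes.1 hc
    have hd' := mem_oppositeCodes.1 hd
    simp only at hc' hd'
    change Congruent (chain k x (-y)) (chain k x' (-y')) at h
    obtain ⟨h1, h2, -⟩ := chain_inj hk (y := y) (y' := y') (by omega) (by omega) (by omega)
      (by omega) (by omega) (by omega) (Or.inr rfl) (Or.inr rfl)
      (endSq_pos_opposite hk (by omega) (by omega) (by omega) (by omega)) h
    norm_cast at h1 h2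
    subst h1 h2
    rfl

lemma exists_code (hk : 3 ≤ k) {P : Set (Set ℂ)} (hP : IsPolyomino k 4 P) :
    ∃ c, Congruent P (polyominoOfCode hk c).1 := by
  rcases isStar_or_isChain hk hP with ⟨g, h, hg, hgh, hl, hc⟩ | ⟨x, y, hx, hxy, h⟩
  · lift g to ℕ using by omega
    lift h to ℕ using by omega
    exact ⟨.inl ⟨(g, h), mem_starCodes.2 (by simp only; omega)⟩, hc⟩
  · lift x to ℕ using by omega
    lift y to ℕ using by omega
    rcases h with ⟨h1, h2, hc⟩ | ⟨h1, hc⟩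
    · exact ⟨.inr (.inl ⟨(x, y), mem_sameCodes.2 (by simp only; omega)⟩), hc⟩
    · exact ⟨.inr (.inr ⟨(x, y), mem_oppositeCodes.2 (by simp only; omega)⟩), hc⟩

lemma a_four_eq (hk : 3 ≤ k) :
    a k 4 = (starCodes k).card + (sameCodes k).card + (oppositeCodes k).card := by
  have hb : Function.Bijective fun c => Quotient.mk (isoSetoid k 4) (polyominoOfCode hk c) := by
    constructor
    · intro c d h
      exact polyominoOfCode_injective hk (Quotient.exact h)
    · intro q
      induction q using Quotient.inductionOn with
      | h P =>
        obtain ⟨c, hc⟩ := exists_code hk P.2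
        exact ⟨c, Quotient.sound (Congruent.symm hc)⟩
  rw [a, ← Nat.card_eq_of_bijective _ hb, Nat.card_sum, Nat.card_sum]
  simp only [Nat.card_eq_fintype_card, Fintype.card_coe]
  ring

/-! ### Counting the codes -/

/-- Split off the pairs with first entry `0`, and subtract `(1, 1)` from the others. -/
lemma card_eq_add_of_shift {S T : Finset (ℕ × ℕ)} {L : ℕ} (h0 : ∀ b, (0, b) ∈ S ↔ b < L)
    (h1 : ∀ a, (a + 1, 0) ∉ S) (h2 : ∀ a b, (a + 1, b + 1) ∈ S ↔ (a, b) ∈ T) :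
    S.card = T.card + L := by
  have hS : S = T.image (fun p => (p.1 + 1, p.2 + 1)) ∪ (Finset.range L).image fun b => (0, b) := by
    ext ⟨a, b⟩
    simp only [Finset.mem_union, Finset.mem_image, Prod.mk.injEq, Finset.mem_range, Prod.exists]
    constructor
    · intro h
      rcases a with _ | a
      · exact Or.inr ⟨b, (h0 b).1 h, rfl, rfl⟩
      · rcases b with _ | b
        · exact absurd h (h1 a)
        · exact Or.inl ⟨a, b, (h2 a b).1 h, rfl, rfl⟩
    · rintro (⟨a, b, h, rfl, rfl⟩ | ⟨b, h, rfl, rfl⟩)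
      · exact (h2 a b).2 h
      · exact (h0 b).2 h
  rw [hS, Finset.card_union_of_disjoint, Finset.card_image_of_injective,
    Finset.card_image_of_injective, Finset.card_range]
  · intro a b h; simpa using h
  · rintro ⟨a, b⟩ ⟨c, d⟩ h; simpa using h
  · rw [Finset.disjoint_left]
    simp only [Finset.mem_image]
    rintro _ ⟨p, -, rfl⟩ ⟨b, -, h⟩
    simp at h

lemma card_eq_of_translate {S T : Finset (ℕ × ℕ)} (M : ℕ) (h0 : ∀ p ∈ S, M ≤ p.1 ∧ M ≤ p.2)
    (h1 : ∀ a b, (a + M, b + M) ∈ S ↔ (a, b) ∈ T) : S.card = T.card := by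
  symm
  apply Finset.card_nbij' (fun p => (p.1 + M, p.2 + M)) (fun p => (p.1 - M, p.2 - M))
  · rintro ⟨a, b⟩ h; exact (h1 a b).2 h
  · rintro ⟨a, b⟩ h
    obtain ⟨h2, h3⟩ := h0 _ h
    simp only at h2 h3
    apply (h1 _ _).1
    simpa [Nat.sub_add_cancel h2, Nat.sub_add_cancel h3] using h
  · rintro ⟨a, b⟩ h; simp
  · rintro ⟨a, b⟩ h
    obtain ⟨h2, h3⟩ := h0 _ h
    simp only at h2 h3
    simp [Nat.sub_add_cancel h2, Nat.sub_add_cancel h3]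

/-- The pairs `a ≤ b < n`. -/
def boxPairs (n : ℕ) : Finset (ℕ × ℕ) :=
  (Finset.range n ×ˢ Finset.range n).filter fun p => p.1 ≤ p.2

/-- The pairs `a ≤ b` with `a + b < n`. -/
def sumPairs (n : ℕ) : Finset (ℕ × ℕ) :=
  (Finset.range n ×ˢ Finset.range n).filter fun p => p.1 ≤ p.2 ∧ p.1 + p.2 < n

/-- The pairs `a ≤ b` with `a + 2 * b ≤ n`; equivalently, the partitions of `n` into at most three
parts. -/
def partPairs (n : ℕ) : Finset (ℕ × ℕ) :=
  (Finset.range (n + 1) ×ˢ Finset.range (n + 1)).filter fun p => p.1 ≤ p.2 ∧ p.1 + 2 * p.2 ≤ n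

lemma mem_boxPairs {n a b : ℕ} : (a, b) ∈ boxPairs n ↔ a ≤ b ∧ b < n := by
  simp only [boxPairs, Finset.mem_filter, Finset.mem_product, Finset.mem_range]
  omega

lemma mem_sumPairs {n a b : ℕ} : (a, b) ∈ sumPairs n ↔ a ≤ b ∧ a + b < n := by
  simp only [sumPairs, Finset.mem_filter, Finset.mem_product, Finset.mem_range]
  omega

lemma mem_partPairs {n a b : ℕ} : (a, b) ∈ partPairs n ↔ a ≤ b ∧ a + 2 * b ≤ n := by
  simp only [partPairs, Finset.mem_filter, Finset.mem_product, Finset.mem_range]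
  omega

lemma card_boxPairs (n : ℕ) : 2 * (boxPairs n).card = n * (n + 1) := by
  induction n with
  | zero => rfl
  | succ n ih =>
    rw [card_eq_add_of_shift (T := boxPairs n) (L := n + 1), mul_add, ih]
    · ring
    · intro b; rw [mem_boxPairs]; omega
    · intro a; rw [mem_boxPairs]; omega
    · intro a b; rw [mem_boxPairs, mem_boxPairs]; omega

lemma card_sumPairs_add_two (n : ℕ) : (sumPairs (n + 2)).card = (sumPairs n).card + (n + 2) := by
  apply card_eq_add_of_shift
  · intro b; rw [mem_sumPairs]; omega
  · intro a; rw [mem_sumPairs]; omega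
  · intro a b; rw [mem_sumPairs, mem_sumPairs]; omega

lemma card_sumPairs_even (j : ℕ) : (sumPairs (2 * j)).card = j * (j + 1) := by
  induction j with
  | zero => rfl
  | succ j ih => rw [mul_add, mul_one, card_sumPairs_add_two, ih]; ring

lemma card_sumPairs_odd (j : ℕ) : (sumPairs (2 * j + 1)).card = (j + 1) ^ 2 := by
  induction j with
  | zero => rfl
  | succ j ih =>
    rw [show 2 * (j + 1) + 1 = 2 * j + 1 + 2 by ring, card_sumPairs_add_two, ih]; ring

lemma card_partPairs_add_three (n : ℕ) :
    (partPairs (n + 3)).card = (partPairs n).card + ((n + 3) / 2 + 1) := by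
  apply card_eq_add_of_shift
  · intro b; rw [mem_partPairs]; omega
  · intro a; rw [mem_partPairs]; omega
  · intro a b; rw [mem_partPairs, mem_partPairs]; omega

lemma card_partPairs (j r : ℕ) :
    (partPairs (6 * j + r)).card = (partPairs r).card + 3 * j ^ 2 + (3 + r) * j := by
  induction j with
  | zero => simp
  | succ j ih =>
    rw [show 6 * (j + 1) + r = 6 * j + r + 3 + 3 by ring, card_partPairs_add_three,
      card_partPairs_add_three, ih]
    have : (6 * j + r + 3 + 3) / 2 + (6 * j + r + 3) / 2 = 6 * j + r + 4 := by omega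
    linarith

/-- The counts in terms of the least admissible gap `M'` and the least admissible bend `M`. Chains
with ends on the same side are all pairs of bends except those with `2 * (x + y) < k`. -/
lemma card_codes (hk : 3 ≤ k) {M M' n N N' m : ℕ} (hM : M = k / 6 + 1) (hM' : M' = (k + 5) / 6)
    (hn : k = 3 * M' + n) (hN : k / 2 + 1 = M + N) (hN' : (k + 1) / 2 = M + N')
    (hm : m = (k + 1) / 2 - 2 * M) :
    a k 4 + (sumPairs m).card =
      (partPairs n).card + (boxPairs N).card + (boxPairs N').card := by
  have h1 : (starCodes k).card = (partPairs n).card := by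
    apply card_eq_of_translate M'
    · intro p hp; rw [mem_starCodes] at hp; omega
    · intro a b; rw [mem_starCodes, mem_partPairs]; simp only; omega
  have h2 : (oppositeCodes k).card = (boxPairs N').card := by
    apply card_eq_of_translate M
    · intro p hp; rw [mem_oppositeCodes] at hp; omega
    · intro a b; rw [mem_oppositeCodes, mem_boxPairs]; simp only; omega
  have h3 : (sameCodes k).card + (sumPairs m).card = (boxPairs N).card := by
    rw [← Finset.card_filter_add_card_filter_not (s := boxPairs N)
      (fun p => k ≤ 2 * (p.1 + p.2 + 2 * M))]
    congr 1
    · apply card_eq_of_translate M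
      · intro p hp; rw [mem_sameCodes] at hp; omega
      · intro a b; rw [mem_sameCodes, Finset.mem_filter, mem_boxPairs]; simp only; omega
    · congr 1
      ext ⟨a, b⟩
      rw [mem_sumPairs, Finset.mem_filter, mem_boxPairs]; simp only; omega
  rw [a_four_eq hk]; omega

lemma two_mul_a_four (hk : 3 ≤ k) {M M' n N N' m c d : ℕ} (hM : M = k / 6 + 1)
    (hM' : M' = (k + 5) / 6) (hn : k = 3 * M' + n) (hN : k / 2 + 1 = M + N)
    (hN' : (k + 1) / 2 = M + N') (hm : m = (k + 1) / 2 - 2 * M) (hc : (partPairs n).card = c)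
    (hd : (sumPairs m).card = d) :
    2 * (a k 4 : ℚ) + 2 * d = 2 * c + N * (N + 1) + N' * (N' + 1) := by
  have h1 := card_codes hk hM hM' hn hN hN' hm
  have h2 := card_boxPairs N
  have h3 := card_boxPairs N'
  rw [hc, hd] at h1
  have h4 : 2 * a k 4 + 2 * d = 2 * c + N * (N + 1) + N' * (N' + 1) := by omega
  exact_mod_cast h4

end KPoly

open KPoly in
theorem mainTheorem2 (k : ℕ) (hk : 3 ≤ k) :
    (k ≡ 0 [MOD 12] → (KPoly.a k 4 : ℚ) = (3 * (k : ℚ) ^ 2 + 8 * k + 24) / 24) ∧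
    (k ≡ 1 [MOD 12] → (KPoly.a k 4 : ℚ) = (3 * (k : ℚ) ^ 2 + 4 * k - 7) / 24) ∧
    (k ≡ 2 [MOD 12] → (KPoly.a k 4 : ℚ) = (3 * (k : ℚ) ^ 2 + 8 * k - 4) / 24) ∧
    (k ≡ 3 [MOD 12] → (KPoly.a k 4 : ℚ) = (3 * (k : ℚ) ^ 2 + 10 * k + 15) / 24) ∧
    (k ≡ 4 [MOD 12] → (KPoly.a k 4 : ℚ) = (3 * (k : ℚ) ^ 2 + 14 * k + 16) / 24) ∧
    (k ≡ 5 [MOD 12] → (KPoly.a k 4 : ℚ) = (3 * (k : ℚ) ^ 2 + 16 * k + 13) / 24) ∧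
    (k ≡ 6 [MOD 12] → (KPoly.a k 4 : ℚ) = (3 * (k : ℚ) ^ 2 + 8 * k + 12) / 24) ∧
    (k ≡ 7 [MOD 12] → (KPoly.a k 4 : ℚ) = (3 * (k : ℚ) ^ 2 + 4 * k - 7) / 24) ∧
    (k ≡ 8 [MOD 12] → (KPoly.a k 4 : ℚ) = (3 * (k : ℚ) ^ 2 + 8 * k + 8) / 24) ∧
    (k ≡ 9 [MOD 12] → (KPoly.a k 4 : ℚ) = (3 * (k : ℚ) ^ 2 + 10 * k + 3) / 24) ∧
    (k ≡ 10 [MOD 12] → (KPoly.a k 4 : ℚ) = (3 * (k : ℚ) ^ 2 + 14 * k + 16) / 24) ∧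
    (k ≡ 11 [MOD 12] → (KPoly.a k 4 : ℚ) = (3 * (k : ℚ) ^ 2 + 16 * k + 13) / 24) := by
  have part : ∀ j r c, (partPairs r).card = c →
      (partPairs (6 * j + r)).card = c + 3 * j ^ 2 + (3 + r) * j := by
    rintro j r c rfl
    exact card_partPairs j r
  refine ⟨fun h => ?_, fun h => ?_, fun h => ?_, fun h => ?_, fun h => ?_, fun h => ?_,
    fun h => ?_, fun h => ?_, fun h => ?_, fun h => ?_, fun h => ?_, fun h => ?_⟩
  · obtain ⟨t, rfl⟩ : ∃ t, k = 12 * t + 12 := ⟨k / 12 - 1, by unfold Nat.ModEq at h; omega⟩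
    have key := two_mul_a_four hk (M := 2 * t + 3) (M' := 2 * t + 2) (n := 6 * (t + 1) + 0)
      (N := 4 * t + 4) (N' := 4 * t + 3) (m := 2 * t) (by omega) (by omega) (by omega) (by omega)
      (by omega) (by omega) (part (t + 1) 0 1 rfl) (card_sumPairs_even t)
    push_cast at key ⊢
    linarith
  · obtain ⟨t, rfl⟩ : ∃ t, k = 12 * t + 13 := ⟨k / 12 - 1, by unfold Nat.ModEq at h; omega⟩
    have key := two_mul_a_four hk (M := 2 * t + 3) (M' := 2 * t + 3) (n := 6 * t + 4)
      (N := 4 * t + 4) (N' := 4 * t + 4) (m := 2 * t + 1) (by omega) (by omega) (by omega) (by omega)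
      (by omega) (by omega) (part t 4 4 rfl) (card_sumPairs_odd t)
    push_cast at key ⊢
    linarith
  · obtain ⟨t, rfl⟩ : ∃ t, k = 12 * t + 14 := ⟨k / 12 - 1, by unfold Nat.ModEq at h; omega⟩
    have key := two_mul_a_four hk (M := 2 * t + 3) (M' := 2 * t + 3) (n := 6 * t + 5)
      (N := 4 * t + 5) (N' := 4 * t + 4) (m := 2 * t + 1) (by omega) (by omega) (by omega) (by omega)
      (by omega) (by omega) (part t 5 5 rfl) (card_sumPairs_odd t)
    push_cast at key ⊢
    linarith
  · obtain ⟨t, rfl⟩ : ∃ t, k = 12 * t + 3 := ⟨k / 12, by unfold Nat.ModEq at h; omega⟩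
    have key := two_mul_a_four hk (M := 2 * t + 1) (M' := 2 * t + 1) (n := 6 * t + 0)
      (N := 4 * t + 1) (N' := 4 * t + 1) (m := 2 * t) (by omega) (by omega) (by omega) (by omega)
      (by omega) (by omega) (part t 0 1 rfl) (card_sumPairs_even t)
    push_cast at key ⊢
    linarith
  · obtain ⟨t, rfl⟩ : ∃ t, k = 12 * t + 4 := ⟨k / 12, by unfold Nat.ModEq at h; omega⟩
    have key := two_mul_a_four hk (M := 2 * t + 1) (M' := 2 * t + 1) (n := 6 * t + 1)
      (N := 4 * t + 2) (N' := 4 * t + 1) (m := 2 * t) (by omega) (by omega) (by omega) (by omega)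
      (by omega) (by omega) (part t 1 1 rfl) (card_sumPairs_even t)
    push_cast at key ⊢
    linarith
  · obtain ⟨t, rfl⟩ : ∃ t, k = 12 * t + 5 := ⟨k / 12, by unfold Nat.ModEq at h; omega⟩
    have key := two_mul_a_four hk (M := 2 * t + 1) (M' := 2 * t + 1) (n := 6 * t + 2)
      (N := 4 * t + 2) (N' := 4 * t + 2) (m := 2 * t + 1) (by omega) (by omega) (by omega) (by omega)
      (by omega) (by omega) (part t 2 2 rfl) (card_sumPairs_odd t)
    push_cast at key ⊢
    linarith
  · obtain ⟨t, rfl⟩ : ∃ t, k = 12 * t + 6 := ⟨k / 12, by unfold Nat.ModEq at h; omega⟩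
    have odd_pred : (sumPairs (2 * t - 1)).card = t ^ 2 := by
      rcases t with _ | t
      · rfl
      · exact card_sumPairs_odd t
    have key := two_mul_a_four hk (M := 2 * t + 2) (M' := 2 * t + 1) (n := 6 * t + 3)
      (N := 4 * t + 2) (N' := 4 * t + 1) (m := 2 * t - 1) (by omega) (by omega) (by omega) (by omega)
      (by omega) (by omega) (part t 3 3 rfl) (odd_pred)
    push_cast at key ⊢
    linarith
  · obtain ⟨t, rfl⟩ : ∃ t, k = 12 * t + 7 := ⟨k / 12, by unfold Nat.ModEq at h; omega⟩
    have key := two_mul_a_four hk (M := 2 * t + 2) (M' := 2 * t + 2) (n := 6 * t + 1)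
      (N := 4 * t + 2) (N' := 4 * t + 2) (m := 2 * t) (by omega) (by omega) (by omega) (by omega)
      (by omega) (by omega) (part t 1 1 rfl) (card_sumPairs_even t)
    push_cast at key ⊢
    linarith
  · obtain ⟨t, rfl⟩ : ∃ t, k = 12 * t + 8 := ⟨k / 12, by unfold Nat.ModEq at h; omega⟩
    have key := two_mul_a_four hk (M := 2 * t + 2) (M' := 2 * t + 2) (n := 6 * t + 2)
      (N := 4 * t + 3) (N' := 4 * t + 2) (m := 2 * t) (by omega) (by omega) (by omega) (by omega)
      (by omega) (by omega) (part t 2 2 rfl) (card_sumPairs_even t)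
    push_cast at key ⊢
    linarith
  · obtain ⟨t, rfl⟩ : ∃ t, k = 12 * t + 9 := ⟨k / 12, by unfold Nat.ModEq at h; omega⟩
    have key := two_mul_a_four hk (M := 2 * t + 2) (M' := 2 * t + 2) (n := 6 * t + 3)
      (N := 4 * t + 3) (N' := 4 * t + 3) (m := 2 * t + 1) (by omega) (by omega) (by omega) (by omega)
      (by omega) (by omega) (part t 3 3 rfl) (card_sumPairs_odd t)
    push_cast at key ⊢
    linarith
  · obtain ⟨t, rfl⟩ : ∃ t, k = 12 * t + 10 := ⟨k / 12, by unfold Nat.ModEq at h; omega⟩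
    have key := two_mul_a_four hk (M := 2 * t + 2) (M' := 2 * t + 2) (n := 6 * t + 4)
      (N := 4 * t + 4) (N' := 4 * t + 3) (m := 2 * t + 1) (by omega) (by omega) (by omega) (by omega)
      (by omega) (by omega) (part t 4 4 rfl) (card_sumPairs_odd t)
    push_cast at key ⊢
    linarith
  · obtain ⟨t, rfl⟩ : ∃ t, k = 12 * t + 11 := ⟨k / 12, by unfold Nat.ModEq at h; omega⟩
    have key := two_mul_a_four hk (M := 2 * t + 2) (M' := 2 * t + 2) (n := 6 * t + 5)
      (N := 4 * t + 4) (N' := 4 * t + 4) (m := 2 * (t + 1)) (by omega) (by omega) (by omega) (by omega)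
      (by omega) (by omega) (part t 5 5 rfl) (card_sumPairs_even (t + 1))
    push_cast at key ⊢
    linarith
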